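/- **Theorem 1.2.** Let $\Omega\subset\mathbb R^n$, $n\ge 2$, be a bounded open set, let $p_k>1$ and $q_k\in(p_k,+\infty)$ for $k=1,\dots,n$, and put $$p_m=\max_{k}p_k,\qquad \frac1{\overline p}=\frac1n\sum_{k=1}^n\frac1{p_k},\qquad \overline p^*=\frac{n\overline p}{n-\overline p},$$ where $\overline p<n$ is assumed. Let $W^{1,(p_k)}(\Omega)$ (respectively $W^{1,(p_k)}_0(\Omega)$) be the set of $v\in W^{1,1}(\Omega)$ (respectively $v\in W^{1,1}_0(\Omega)$) with $D_kv\in L^{p_k}(\Omega)$ for every $k$, and similarly for $(q_k)$. Let $0\le h\in L^{\tau}(\Omega)$ with $\tau=\max_k q_k/p_k$, and let $a_i:\Omega\times\mathbb R^n\to\mathbb R$, $i=1,\dots,n$, be Carathéodory functions such that, for some constants $c_1$ and $\tilde\nu\in(0,+\infty)$, for almost every $x\in\Omega$, all $z,\tilde z\in\mathbb R^n$ and all $i$, $$|a_i(x,z)|\le c_1\Big(h(x)+\sum_{j=1}^n|z_j|^{p_j}\Big)^{1-1/p_i},\qquad \tilde\nu\sum_{j=1}^n|z_j-\tilde z_j|^{p_j}\le\sum_{j=1}^n\big(a_j(x,z)-a_j(x,\tilde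 z)\big)(z_j-\tilde z_j).$$ Let $\theta\in W^{1,(q_k)}(\Omega)$, let $b$ be any number with $$0<b\le\min_{j}\Big(1-\frac{p_j}{q_j}\Big)\min_{i}\Big(1-\frac1{p_i}\Big)\quad\text{and}\quad b<\frac{p_m-1}{p_m}\,\frac{\overline p}{\overline p^*},$$ and let $f^i\in L^{p_i/(p_i-1-bp_i)}(\Omega)$, $i=1,\dots,n$. Let $u\in\theta+W^{1,(p_k)}_0(\Omega)$ be a solution of the Dirichlet problem $\sum_i D_i(a_i(x,Du))=\sum_i D_if^i$ in $\Omega$, $u=\theta$ on $\partial\Omega$, that is, $$\int_\Omega\sum_{i=1}^n a_i(x,Du)\,D_i\varphi\,dx=\int_\Omega\sum_{i=1}^n f^i\,D_i\varphi\,dx\qquad\text{for all }\varphi\in W^{1,(p_k)}_0(\Omega).$$ Then, with $$t=\frac{\overline p^*}{1-\frac{b\,\overline p^*}{\overline p}\,\frac{p_m}{p_m-1}},$$ one has $t>\overline p^*$ and $u-\theta\in L^t_{weak}(\Omega)$, i.e. $u-\theta$ is measurable and there is a constant $K>0$ such that $|\{x\in\Omega:|u(x)-\theta(x)|>s\}|\le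 K/s^{t}$ for every $s>0$. -/

import Mathlib

open MeasureTheory Filter Topology
open scoped ContDiff ENNReal

namespace AnisoDirichlet

/-- A point of `ℝⁿ` is a function `Fin n → ℝ`, with Lebesgue measure `volume`. Only the topology,
the bornology, the smooth structure and the measure of `ℝⁿ` are used, never a particular norm. -/
abbrev Pt (n : ℕ) : Type := Fin n → ℝ

variable {n : ℕ}

/-- The classical partial derivative `∂φ/∂x_k`. -/
noncomputable def partialDeriv (k : Fin n) (φ : Pt n → ℝ) (x : Pt n) : ℝ :=
  fderiv ℝ φ x (Pi.single k 1)

/-- `φ ∈ C_c^∞(Ω)`. -/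
structure IsTestFunction (Ω : Set (Pt n)) (φ : Pt n → ℝ) : Prop where
  smooth : ContDiff ℝ ∞ φ
  compact : HasCompactSupport φ
  support : tsupport φ ⊆ Ω

/-- `g` is (a representative of) the weak partial derivative `D_k v` of `v` in `Ω`. -/
structure HasWeakPartial (Ω : Set (Pt n)) (k : Fin n) (v g : Pt n → ℝ) : Prop where
  locInt_fun : LocallyIntegrableOn v Ω volume
  locInt_deriv : LocallyIntegrableOn g Ω volume
  parts : ∀ φ : Pt n → ℝ, IsTestFunction Ω φ →
    ∫ x in Ω, v x * partialDeriv k φ x = - ∫ x in Ω, g x * φ x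

/-- `f ∈ L^r(Ω)` for a real exponent `r`. -/
def InLp (Ω : Set (Pt n)) (r : ℝ) (f : Pt n → ℝ) : Prop :=
  MemLp f (ENNReal.ofReal r) (volume.restrict Ω)

/-- `W^{1,1}(Ω)`. -/
def sobolev11 (Ω : Set (Pt n)) : Set (Pt n → ℝ) :=
  {v | InLp Ω 1 v ∧ ∀ k, ∃ g, HasWeakPartial Ω k v g ∧ InLp Ω 1 g}

/-- `W_0^{1,1}(Ω)`, the closure of `C_c^∞(Ω)` in `W^{1,1}(Ω)`. -/
def sobolev11Zero (Ω : Set (Pt n)) : Set (Pt n → ℝ) :=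
  {v | v ∈ sobolev11 Ω ∧ ∃ g : Fin n → Pt n → ℝ, (∀ k, HasWeakPartial Ω k v (g k)) ∧
    ∃ φ : ℕ → Pt n → ℝ, (∀ m, IsTestFunction Ω (φ m)) ∧
      Tendsto (fun m => eLpNorm (fun x => v x - φ m x) 1 (volume.restrict Ω)) atTop (𝓝 0) ∧
      ∀ k, Tendsto (fun m => eLpNorm (fun x => g k x - partialDeriv k (φ m) x) 1
        (volume.restrict Ω)) atTop (𝓝 0)}

/-- `W^{1,(p_k)}(Ω) = {v ∈ W^{1,1}(Ω) : D_k v ∈ L^{p_k}(Ω) for every k}`. -/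
def anisoSobolev (Ω : Set (Pt n)) (p : Fin n → ℝ) : Set (Pt n → ℝ) :=
  {v | v ∈ sobolev11 Ω ∧ ∀ k, ∃ g, HasWeakPartial Ω k v g ∧ InLp Ω (p k) g}

/-- `W_0^{1,(p_k)}(Ω) = {v ∈ W_0^{1,1}(Ω) : D_k v ∈ L^{p_k}(Ω) for every k}`. -/
def anisoSobolevZero (Ω : Set (Pt n)) (p : Fin n → ℝ) : Set (Pt n → ℝ) :=
  {v | v ∈ sobolev11Zero Ω ∧ ∀ k, ∃ g, HasWeakPartial Ω k v g ∧ InLp Ω (p k) g}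

/-- `L^t_weak(Ω)`: measurable `f` with `|{x ∈ Ω : |f x| > s}| ≤ K / s ^ t` for all `s > 0`. -/
def weakLp (Ω : Set (Pt n)) (t : ℝ) : Set (Pt n → ℝ) :=
  {f | AEStronglyMeasurable f (volume.restrict Ω) ∧
    ∃ K : ℝ, 0 < K ∧ ∀ s : ℝ, 0 < s →
      volume {x ∈ Ω | s < |f x|} ≤ ENNReal.ofReal (K / s ^ t)}

/-- `a : Ω × ℝⁿ → ℝ` is a Carathéodory function: measurable in `x ∈ Ω` for each `z`, and
continuous in `z` for almost every `x ∈ Ω`. -/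
structure IsCaratheodory (Ω : Set (Pt n)) (a : Pt n → Pt n → ℝ) : Prop where
  meas : ∀ z, AEStronglyMeasurable (fun x => a x z) (volume.restrict Ω)
  cont : ∀ᵐ x ∂(volume.restrict Ω), Continuous (a x)

/-- `u` is a solution of the boundary value problem `∑ D_i (a_i(x, Du)) = ∑ D_i f^i` in `Ω`,
`u = θ` on `∂Ω`: `u ∈ θ + W_0^{1,(p_k)}(Ω)`, and the weak form of the equation holds for every
`φ ∈ W_0^{1,(p_k)}(Ω)`. Weak derivatives are unique up to null sets, so the representatives
`Du` and `Dφ` do not matter. -/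
def IsDirichletSolution (Ω : Set (Pt n)) (p : Fin n → ℝ) (a : Fin n → Pt n → Pt n → ℝ)
    (f : Fin n → Pt n → ℝ) (θ u : Pt n → ℝ) : Prop :=
  u - θ ∈ anisoSobolevZero Ω p ∧
  ∃ Du : Fin n → Pt n → ℝ, (∀ k, HasWeakPartial Ω k u (Du k)) ∧
    ∀ φ ∈ anisoSobolevZero Ω p, ∀ Dφ : Fin n → Pt n → ℝ,
      (∀ k, HasWeakPartial Ω k φ (Dφ k)) →
      ∫ x in Ω, ∑ i, a i x (fun j => Du j x) * Dφ i x = ∫ x in Ω, ∑ i, f i x * Dφ i x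

/-- The maximum `p_m` of the exponents. -/
noncomputable def pMax (p : Fin n → ℝ) : ℝ := ⨆ k, p k

/-- The harmonic mean of the exponents, `1 / p̄ = (1 / n) ∑ 1 / p_k`. -/
noncomputable def pBar (p : Fin n → ℝ) : ℝ := ((1 / (n : ℝ)) * ∑ k, 1 / p k)⁻¹

/-- The Sobolev exponent `p̄* = n p̄ / (n - p̄)`, used for `p̄ < n`. -/
noncomputable def pBarStar (p : Fin n → ℝ) : ℝ := n * pBar p / (n - pBar p)

/-- `t = p̄* / (1 - (b p̄* / p̄) (p_m / (p_m - 1)))`. -/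
noncomputable def tExp (p : Fin n → ℝ) (b : ℝ) : ℝ :=
  pBarStar p / (1 - b * pBarStar p / pBar p * (pMax p / (pMax p - 1)))

end AnisoDirichlet

open AnisoDirichlet

namespace AnisoDirichlet

/-! Write v = u - θ and m(L) = |{|v| > L}|, and let p' denote the conjugate exponent p/(p - 1). Let
G be a smooth odd truncation vanishing on [-L, L] and constant on each side beyond ±2L. Testing the
equation with G(v) gives an identity weighted by χ = G'(v), which has values in [0, 1] and lives on
{|v| > L}. Monotonicity between Du and Dθ, then Young, bound ∫ χ |D_j v|^{p_j} by the integrals of χ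
|f^i - a_i(x, Dθ)|^{p_i'}. The extra integrability of Dθ and the first bound on b put a_i(x, Dθ) in
the same Lebesgue space as f^i, so Hölder makes the i-th term O(m(L)^{b p_i'}); the smallest of
these powers is b p_m' (`exists_energy_decay`).

The anisotropic Sobolev inequality (`exists_anisotropic_sobolev`), applied to G(v), whose modulus is
a fixed multiple of L on {|v| > 2L}, yields m(2L) ≤ C L^{-p̄*} m(L)^β with β = b p_m' p̄*/p̄. The
second bound on b says that β < 1, and dyadic iteration (`exists_decay_of_doubling`) gives decay of
order L^{-p̄*/(1-β)}, which is L^{-t}.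

The Sobolev inequality is proved by Gagliardo's method: line integrals of the derivatives of
|w|^{γ_j}, Loomis–Whitney, Hölder, and absorption of a sublinear power. Facts about zero boundary
values are obtained through approximating test functions (`IsTestLimit`), a class stable under
composition with smooth G (`IsTestLimit.comp`); this is why the truncation is smooth and not
piecewise linear. -/

variable {n : ℕ} {Ω : Set (Pt n)}

/-! ### Test functions and weak derivatives -/

theorem IsTestFunction.partialDeriv {φ : Pt n → ℝ} (h : IsTestFunction Ω φ) (k : Fin n) :
    IsTestFunction Ω (partialDeriv k φ) := by
  have hsub : tsupport (AnisoDirichlet.partialDeriv k φ) ⊆ tsupport φ := by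
    refine closure_minimal (fun x hx => ?_) (isClosed_tsupport φ)
    by_contra hx'
    have : fderiv ℝ φ x = 0 := by
      by_contra h0
      exact hx' (support_fderiv_subset ℝ h0)
    simp [AnisoDirichlet.partialDeriv, this] at hx
  refine ⟨?_, ?_, hsub.trans h.support⟩
  · exact (h.smooth.fderiv_right (m := ∞) (by simp)).clm_apply contDiff_const
  · exact h.compact.of_isClosed_subset (isClosed_tsupport _) hsub

theorem IsTestFunction.exists_bound {φ : Pt n → ℝ} (h : IsTestFunction Ω φ) :
    ∃ C, ∀ x, ‖φ x‖ ≤ C :=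
  h.smooth.continuous.bounded_above_of_compact_support h.compact

theorem IsTestFunction.integrable {φ : Pt n → ℝ} (h : IsTestFunction Ω φ) :
    Integrable φ :=
  h.smooth.continuous.integrable_of_hasCompactSupport h.compact

theorem IsTestFunction.integrable_mul {φ : Pt n → ℝ} (h : IsTestFunction Ω φ)
    {v : Pt n → ℝ} {μ : Measure (Pt n)} (hv : Integrable v μ) :
    Integrable (fun x => v x * φ x) μ := by
  obtain ⟨C, hC⟩ := h.exists_bound
  exact hv.mul_bdd h.smooth.continuous.aestronglyMeasurable (Eventually.of_forall hC)

theorem IsTestFunction.eq_zero_of_notMem {φ : Pt n → ℝ} (h : IsTestFunction Ω φ)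
    {x : Pt n} (hx : x ∉ Ω) : φ x = 0 := by
  by_contra h0
  exact hx (h.support (subset_tsupport φ h0))

theorem InLp.integrable {v : Pt n → ℝ} (h : InLp Ω 1 v) : Integrable v (volume.restrict Ω) := by
  rw [InLp, ENNReal.ofReal_one] at h
  exact memLp_one_iff_integrable.1 h

theorem inLp_one_iff {v : Pt n → ℝ} : InLp Ω 1 v ↔ Integrable v (volume.restrict Ω) := by
  rw [InLp, ENNReal.ofReal_one]
  exact memLp_one_iff_integrable

/-- The fundamental lemma of the calculus of variations. It makes the various representatives of a
weak gradient interchangeable. -/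
theorem HasWeakPartial.ae_eq (hΩ : IsOpen Ω) {k : Fin n} {v g g' : Pt n → ℝ}
    (h : HasWeakPartial Ω k v g) (h' : HasWeakPartial Ω k v g') :
    g =ᵐ[volume.restrict Ω] g' := by
  have key := hΩ.ae_eq_zero_of_integral_contDiff_smul_eq_zero (μ := volume)
    (f := fun x => g x - g' x) (h.locInt_deriv.sub h'.locInt_deriv) ?_
  · rw [EventuallyEq, ae_restrict_iff' hΩ.measurableSet]
    filter_upwards [key] with x hx hxΩ
    exact sub_eq_zero.1 (hx hxΩ)
  intro φ h1 h2 h3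
  have hφ : IsTestFunction Ω φ := ⟨h1, h2, h3⟩
  have hint : ∀ w : Pt n → ℝ, LocallyIntegrableOn w Ω volume →
      Integrable (fun x => w x * φ x) (volume.restrict Ω) := by
    intro w hw
    have hw' : IntegrableOn w (tsupport φ) :=
      hw.integrableOn_compact_subset h3 h2
    have h4 : IntegrableOn (fun x => w x * φ x) (tsupport φ) := hφ.integrable_mul hw'
    refine (h4.integrable_of_forall_notMem_eq_zero ?_).integrableOn
    intro x hx
    rw [image_eq_zero_of_notMem_tsupport hx, mul_zero]
  have e : ∫ x in Ω, g x * φ x = ∫ x in Ω, g' x * φ x := by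
    have := (h.parts φ hφ).symm.trans (h'.parts φ hφ)
    linarith
  have e2 : ∫ x in Ω, (g x * φ x - g' x * φ x) = 0 := by
    rw [integral_sub (hint g h.locInt_deriv) (hint g' h'.locInt_deriv), e, sub_self]
  rw [← e2, ← integral_indicator hΩ.measurableSet]
  congr 1
  ext x
  by_cases hx : x ∈ Ω
  · simp [hx]; ring
  · simp [hx, hφ.eq_zero_of_notMem hx]

theorem HasWeakPartial.add {k : Fin n} {v w g g' : Pt n → ℝ}
    (h : HasWeakPartial Ω k v g) (h' : HasWeakPartial Ω k w g')
    (hv : Integrable v (volume.restrict Ω)) (hw : Integrable w (volume.restrict Ω))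
    (hg : Integrable g (volume.restrict Ω)) (hg' : Integrable g' (volume.restrict Ω)) :
    HasWeakPartial Ω k (v + w) (g + g') := by
  refine ⟨h.locInt_fun.add h'.locInt_fun, h.locInt_deriv.add h'.locInt_deriv, fun φ hφ => ?_⟩
  simp only [Pi.add_apply, add_mul]
  rw [integral_add ((hφ.partialDeriv k).integrable_mul hv) ((hφ.partialDeriv k).integrable_mul hw),
    integral_add (hφ.integrable_mul hg) (hφ.integrable_mul hg'), h.parts φ hφ, h'.parts φ hφ]
  ring

/-! ### Convergence of products in L¹ -/

section Convergence

variable {α : Type*} [MeasurableSpace α] {μ : Measure α}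

/-- If `c m → c` almost everywhere and boundedly, and `D m → D` in `L¹`, then
`c m * D m → c * D` in `L¹`. -/
theorem tendsto_eLpNorm_one_mul {c : ℕ → α → ℝ} {c' : α → ℝ} {D : ℕ → α → ℝ} {D' : α → ℝ}
    {B : ℝ} (hcm : ∀ m, AEStronglyMeasurable (c m) μ)
    (hB : ∀ m, ∀ x, |c m x| ≤ B)
    (hc : ∀ᵐ x ∂μ, Tendsto (fun m => c m x) atTop (𝓝 (c' x)))
    (hDm : ∀ m, AEStronglyMeasurable (D m) μ) (hD' : Integrable D' μ)
    (hD : Tendsto (fun m => eLpNorm (fun x => D' x - D m x) 1 μ) atTop (𝓝 0)) :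
    Tendsto (fun m => eLpNorm (fun x => c' x * D' x - c m x * D m x) 1 μ) atTop (𝓝 0) := by
  have hc'm : AEStronglyMeasurable c' μ := aestronglyMeasurable_of_tendsto_ae atTop hcm hc
  have h1 : Tendsto (fun m => eLpNorm (fun x => (c' x - c m x) * D' x) 1 μ) atTop (𝓝 0) := by
    simp only [eLpNorm_one_eq_lintegral_enorm]
    have := tendsto_lintegral_of_dominated_convergence' (μ := μ)
      (F := fun m x => ‖(c' x - c m x) * D' x‖ₑ) (f := fun _ => 0)
      (fun x => ENNReal.ofReal (2 * B) * ‖D' x‖ₑ) ?_ ?_ ?_ ?_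
    · simpa using this
    · exact fun m => ((hc'm.sub (hcm m)).mul hD'.aestronglyMeasurable).enorm
    · intro m
      filter_upwards [hc] with x hx
      have hb : |c' x| ≤ B := le_of_tendsto hx.abs (Eventually.of_forall fun m => hB m x)
      rw [enorm_mul]
      gcongr
      rw [Real.enorm_eq_ofReal_abs]
      apply ENNReal.ofReal_le_ofReal
      calc |c' x - c m x| ≤ |c' x| + |c m x| := abs_sub _ _
        _ ≤ 2 * B := by linarith [hB m x]
    · rw [lintegral_const_mul'' _ hD'.aestronglyMeasurable.enorm]
      exact ENNReal.mul_ne_top ENNReal.ofReal_ne_top hD'.hasFiniteIntegral.ne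
    · filter_upwards [hc] with x hx
      have : Tendsto (fun m => (c' x - c m x) * D' x) atTop (𝓝 ((c' x - c' x) * D' x)) :=
        (tendsto_const_nhds.sub hx).mul_const _
      simpa using this.enorm
  have h2 : Tendsto (fun m => ENNReal.ofReal B * eLpNorm (fun x => D' x - D m x) 1 μ) atTop
      (𝓝 0) := by
    simpa using ENNReal.Tendsto.const_mul hD (Or.inr (ENNReal.ofReal_ne_top (r := B)))
  refine tendsto_of_tendsto_of_tendsto_of_le_of_le tendsto_const_nhds
    (by simpa using h1.add h2) (fun _ => zero_le) (fun m => ?_)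
  -- The first summand tends to 0 by dominated convergence, the second because the c m are uniformly
  -- bounded.
  have e : (fun x => c' x * D' x - c m x * D m x)
      = (fun x => (c' x - c m x) * D' x) + (fun x => c m x * (D' x - D m x)) := by
    ext x; simp only [Pi.add_apply]; ring
  rw [e]
  refine (eLpNorm_add_le ((hc'm.sub (hcm m)).mul hD'.aestronglyMeasurable)
    ((hcm m).mul (hD'.aestronglyMeasurable.sub (hDm m))) le_rfl).trans ?_
  refine add_le_add le_rfl ?_
  simp only [eLpNorm_one_eq_lintegral_enorm]
  refine le_trans ?_ (lintegral_const_mul'' (ENNReal.ofReal B)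
    (f := fun x => ‖D' x - D m x‖ₑ) (hD'.aestronglyMeasurable.sub (hDm m)).enorm).le
  refine lintegral_mono fun x => ?_
  simp only [Pi.mul_apply, Pi.sub_apply, enorm_mul]
  gcongr
  rw [Real.enorm_eq_ofReal_abs]
  exact ENNReal.ofReal_le_ofReal (hB m x)

theorem tendsto_integral_of_tendsto_eLpNorm_one {D : ℕ → α → ℝ} {D' : α → ℝ}
    (hDm : ∀ m, Integrable (D m) μ) (hD' : Integrable D' μ)
    (hD : Tendsto (fun m => eLpNorm (fun x => D' x - D m x) 1 μ) atTop (𝓝 0)) :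
    Tendsto (fun m => ∫ x, D m x ∂μ) atTop (𝓝 (∫ x, D' x ∂μ)) := by
  refine tendsto_integral_of_L1' D' hD'.1 (Eventually.of_forall hDm) ?_
  convert hD using 2 with m
  exact eLpNorm_sub_comm _ _ _ _

end Convergence

/-! ### Limits of test functions and the chain rule -/

theorem hasWeakPartial_of_test {φ : Pt n → ℝ} (hφ : IsTestFunction Ω φ)
    (k : Fin n) : HasWeakPartial Ω k φ (partialDeriv k φ) := by
  refine ⟨hφ.integrable.locallyIntegrable.locallyIntegrableOn Ω,
    (hφ.partialDeriv k).integrable.locallyIntegrable.locallyIntegrableOn Ω, fun ψ hψ => ?_⟩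
  rw [setIntegral_eq_integral_of_forall_compl_eq_zero
      (fun x hx => by rw [hφ.eq_zero_of_notMem hx, zero_mul]),
    setIntegral_eq_integral_of_forall_compl_eq_zero
      (fun x hx => by rw [hψ.eq_zero_of_notMem hx, mul_zero])]
  refine integral_mul_fderiv_eq_neg_fderiv_mul_of_integrable (μ := volume)
    (f := φ) (g := ψ) (v := Pi.single k 1)
    (hψ.integrable_mul (hφ.partialDeriv k).integrable)
    ((hψ.partialDeriv k).integrable_mul hφ.integrable)
    (hψ.integrable_mul hφ.integrable)
    (fun x _ => (hφ.smooth.differentiable (by simp)).differentiableAt)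
    (fun x _ => (hψ.smooth.differentiable (by simp)).differentiableAt)

/-- Both sides of the integration by parts formula for φ m pass to the limit, since ψ and its
derivatives are bounded. -/
theorem hasWeakPartial_of_tendsto {k : Fin n} {w D : Pt n → ℝ}
    {φ : ℕ → Pt n → ℝ} (hφ : ∀ m, IsTestFunction Ω (φ m))
    (hw : Integrable w (volume.restrict Ω)) (hD : Integrable D (volume.restrict Ω))
    (h1 : Tendsto (fun m => eLpNorm (fun x => w x - φ m x) 1 (volume.restrict Ω)) atTop (𝓝 0))
    (h2 : Tendsto (fun m => eLpNorm (fun x => D x - partialDeriv k (φ m) x) 1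
      (volume.restrict Ω)) atTop (𝓝 0)) :
    HasWeakPartial Ω k w D := by
  have hw' : IntegrableOn w Ω := hw
  have hD' : IntegrableOn D Ω := hD
  refine ⟨hw'.locallyIntegrableOn, hD'.locallyIntegrableOn, fun ψ hψ => ?_⟩
  have aux : ∀ (η : Pt n → ℝ) (_ : IsTestFunction Ω η) (W : Pt n → ℝ) (F : ℕ → Pt n → ℝ)
      (_ : Integrable W (volume.restrict Ω)) (_ : ∀ m, Integrable (F m) (volume.restrict Ω))
      (_ : Tendsto (fun m => eLpNorm (fun x => W x - F m x) 1 (volume.restrict Ω)) atTop (𝓝 0)),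
      Tendsto (fun m => ∫ x in Ω, F m x * η x) atTop (𝓝 (∫ x in Ω, W x * η x)) := by
    intro η hη W F hW hF hlim
    obtain ⟨C, hC⟩ := hη.exists_bound
    refine tendsto_integral_of_tendsto_eLpNorm_one (fun m => hη.integrable_mul (hF m))
      (hη.integrable_mul hW) ?_
    have := tendsto_eLpNorm_one_mul (c := fun _ => η) (c' := η)
      (fun _ => hη.smooth.continuous.aestronglyMeasurable) (fun _ x => hC x)
      (Eventually.of_forall fun x => tendsto_const_nhds) (fun m => (hF m).aestronglyMeasurable)
      hW hlim
    simpa only [mul_comm (η _)] using this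
  have l1 := aux _ (hψ.partialDeriv k) w φ hw (fun m => (hφ m).integrable.integrableOn) h1
  have l2 := aux _ hψ D _ hD (fun m => ((hφ m).partialDeriv k).integrable.integrableOn) h2
  refine tendsto_nhds_unique l1 ?_
  refine l2.neg.congr fun m => ?_
  exact ((hasWeakPartial_of_test (hφ m) k).parts ψ hψ).symm

/-- `v` is the limit in `W^{1,1}(Ω)` and almost everywhere of the test functions `φ m`, and
`g k` is the limit of their `k`-th partial derivatives. -/
structure IsTestLimit (Ω : Set (Pt n)) (v : Pt n → ℝ) (g : Fin n → Pt n → ℝ)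
    (φ : ℕ → Pt n → ℝ) : Prop where
  test : ∀ m, IsTestFunction Ω (φ m)
  integrable_fun : Integrable v (volume.restrict Ω)
  integrable_deriv : ∀ k, Integrable (g k) (volume.restrict Ω)
  tendsto_ae : ∀ᵐ x ∂(volume.restrict Ω), Tendsto (fun m => φ m x) atTop (𝓝 (v x))
  tendsto_fun : Tendsto (fun m => eLpNorm (fun x => v x - φ m x) 1 (volume.restrict Ω))
    atTop (𝓝 0)
  tendsto_deriv : ∀ k, Tendsto (fun m => eLpNorm (fun x => g k x - partialDeriv k (φ m) x) 1
    (volume.restrict Ω)) atTop (𝓝 0)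

theorem integrable_of_mem_sobolev11 (hΩ : IsOpen Ω) {v : Pt n → ℝ} (hv : v ∈ sobolev11 Ω)
    {k : Fin n} {g : Pt n → ℝ} (hg : HasWeakPartial Ω k v g) :
    Integrable g (volume.restrict Ω) := by
  obtain ⟨g', h1, h2⟩ := hv.2 k
  exact h2.integrable.congr (h1.ae_eq hΩ hg)

/-- L¹ convergence gives almost everywhere convergence along a subsequence, and uniqueness of weak
derivatives allows the representative g to be prescribed. -/
theorem exists_isTestLimit (hΩ : IsOpen Ω) {v : Pt n → ℝ} (hv : v ∈ sobolev11Zero Ω)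
    {g : Fin n → Pt n → ℝ} (hg : ∀ k, HasWeakPartial Ω k v (g k)) :
    ∃ φ, IsTestLimit Ω v g φ := by
  obtain ⟨hv1, g', hg', φ, hφ, hlim, hlim'⟩ := hv
  have hvi := hv1.1.integrable
  obtain ⟨ns, hns, hae⟩ := (tendstoInMeasure_of_tendsto_eLpNorm (μ := volume.restrict Ω)
    (f := φ) (g := v) one_ne_zero
    (fun m => (hφ m).smooth.continuous.aestronglyMeasurable) hvi.aestronglyMeasurable (by
      convert hlim using 2 with m
      exact eLpNorm_sub_comm _ _ _ _)).exists_seq_tendsto_ae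
  refine ⟨fun m => φ (ns m), fun m => hφ _, hvi,
    fun k => integrable_of_mem_sobolev11 hΩ hv1 (hg k), hae, hlim.comp hns.tendsto_atTop,
    fun k => ?_⟩
  refine ((hlim' k).comp hns.tendsto_atTop).congr fun m => ?_
  refine eLpNorm_congr_ae ?_
  filter_upwards [(hg' k).ae_eq hΩ (hg k)] with x hx
  rw [hx]

theorem IsTestLimit.hasWeakPartial {v : Pt n → ℝ} {g : Fin n → Pt n → ℝ} {φ : ℕ → Pt n → ℝ}
    (h : IsTestLimit Ω v g φ) (k : Fin n) : HasWeakPartial Ω k v (g k) :=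
  hasWeakPartial_of_tendsto h.test h.integrable_fun (h.integrable_deriv k) h.tendsto_fun
    (h.tendsto_deriv k)

theorem IsTestLimit.mem_sobolev11Zero {v : Pt n → ℝ} {g : Fin n → Pt n → ℝ} {φ : ℕ → Pt n → ℝ}
    (h : IsTestLimit Ω v g φ) : v ∈ sobolev11Zero Ω :=
  ⟨⟨inLp_one_iff.2 h.integrable_fun,
    fun k => ⟨g k, h.hasWeakPartial k, inLp_one_iff.2 (h.integrable_deriv k)⟩⟩,
    g, h.hasWeakPartial, φ, h.test, h.tendsto_fun, h.tendsto_deriv⟩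

theorem IsTestFunction.comp {φ : Pt n → ℝ} (hφ : IsTestFunction Ω φ) {G : ℝ → ℝ}
    (hG : ContDiff ℝ ∞ G) (hG0 : G 0 = 0) : IsTestFunction Ω (fun x => G (φ x)) := by
  refine ⟨hG.comp hφ.smooth, hφ.compact.comp_left hG0, ?_⟩
  refine (closure_mono ?_).trans hφ.support
  exact Function.support_comp_subset hG0 φ

theorem partialDeriv_comp {φ : Pt n → ℝ} (hφ : Differentiable ℝ φ) {G : ℝ → ℝ}
    (hG : Differentiable ℝ G) (k : Fin n) (x : Pt n) :
    partialDeriv k (fun x => G (φ x)) x = deriv G (φ x) * partialDeriv k φ x := by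
  have := (hG (φ x)).hasDerivAt.comp_hasFDerivAt x (hφ x).hasFDerivAt
  unfold partialDeriv
  rw [HasFDerivAt.fderiv (f := fun x => G (φ x)) this]
  simp

/-- G' is continuous and bounded, so G'(φ m) converges boundedly almost everywhere while the
gradients converge in L¹; hence their products converge in L¹. The condition `hG0` keeps the
supports compact. -/
theorem IsTestLimit.comp {v : Pt n → ℝ} {g : Fin n → Pt n → ℝ} {φ : ℕ → Pt n → ℝ}
    (h : IsTestLimit Ω v g φ) {G : ℝ → ℝ} (hG : ContDiff ℝ ∞ G) (hG0 : G 0 = 0)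
    (hG1 : ∀ y, |deriv G y| ≤ 1) :
    IsTestLimit Ω (fun x => G (v x)) (fun k x => deriv G (v x) * g k x)
      (fun m x => G (φ m x)) := by
  have hGd : Differentiable ℝ G := hG.differentiable (by simp)
  have hG'c : Continuous (deriv G) := hG.continuous_deriv (by simp)
  have hlip : ∀ y z, |G y - G z| ≤ |y - z| := fun y z => by
    simpa using Convex.norm_image_sub_le_of_norm_deriv_le (f := G) (s := Set.univ) (C := 1)
      (fun x _ => hGd x) (fun x _ => hG1 x) convex_univ (Set.mem_univ z) (Set.mem_univ y)
  have hvm := h.integrable_fun.aestronglyMeasurable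
  refine ⟨fun m => (h.test m).comp hG hG0, ?_, fun k => ?_, ?_, ?_, fun k => ?_⟩
  · refine h.integrable_fun.mono (hG.continuous.comp_aestronglyMeasurable hvm)
      (Eventually.of_forall fun x => ?_)
    simpa [hG0] using hlip (v x) 0
  · exact (h.integrable_deriv k).bdd_mul (c := 1) (hG'c.comp_aestronglyMeasurable hvm)
      (Eventually.of_forall fun x => hG1 _)
  · filter_upwards [h.tendsto_ae] with x hx
    exact (hG.continuous.tendsto _).comp hx
  · refine tendsto_of_tendsto_of_tendsto_of_le_of_le tendsto_const_nhds h.tendsto_fun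
      (fun _ => zero_le) fun m => eLpNorm_mono fun x => hlip _ _
  · have hd : ∀ m, Differentiable ℝ (φ m) := fun m => (h.test m).smooth.differentiable (by simp)
    simp only [partialDeriv_comp (hd _) hGd]
    refine tendsto_eLpNorm_one_mul (B := 1)
      (fun m => (hG'c.comp (h.test m).smooth.continuous).aestronglyMeasurable)
      (fun m x => hG1 _) ?_
      (fun m => ((h.test m).partialDeriv k).smooth.continuous.aestronglyMeasurable)
      (h.integrable_deriv k) (h.tendsto_deriv k)
    filter_upwards [h.tendsto_ae] with x hx
    exact (hG'c.tendsto _).comp hx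

/-! ### Smooth truncations -/

/-- A constant bounding the derivative of the smooth transition function. -/
theorem exists_deriv_smoothTransition_le :
    ∃ C, 0 < C ∧ ∀ x, |deriv Real.smoothTransition x| ≤ C := by
  have hc : Continuous (deriv Real.smoothTransition) :=
    (Real.smoothTransition.contDiff (n := 1)).continuous_deriv (by simp)
  obtain ⟨C, hC⟩ := (isCompact_Icc (a := (0 : ℝ)) (b := 1)).exists_bound_of_continuousOn
    hc.continuousOn
  refine ⟨max C 1, by positivity, fun x => ?_⟩
  by_cases hx : x ∈ Set.Icc (0 : ℝ) 1
  · exact (hC x hx).trans (le_max_left _ _)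
  · have h0 : deriv Real.smoothTransition x = 0 := by
      rw [Set.mem_Icc, not_and_or, not_le, not_le] at hx
      rcases hx with hx | hx
      · have : Real.smoothTransition =ᶠ[𝓝 x] fun _ => 0 := by
          filter_upwards [eventually_lt_nhds hx] with y hy
          exact Real.smoothTransition.zero_of_nonpos hy.le
        rw [this.deriv_eq, deriv_const]
      · have : Real.smoothTransition =ᶠ[𝓝 x] fun _ => 1 := by
          filter_upwards [eventually_gt_nhds hx] with y hy
          exact Real.smoothTransition.one_of_one_le hy.le
        rw [this.deriv_eq, deriv_const]
    rw [h0]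
    simp

/-- A smooth odd truncation: it vanishes on `[-L, L]`, is constant beyond `±M`, and has slopes
in `[0, 1]`. -/
theorem exists_smooth_truncation : ∃ c : ℝ, 0 < c ∧ ∀ L M : ℝ, 0 < L → L < M →
    ∃ G : ℝ → ℝ, ContDiff ℝ ∞ G ∧ (∀ y, |y| ≤ L → G y = 0 ∧ deriv G y = 0) ∧
      (∀ y, 0 ≤ deriv G y ∧ deriv G y ≤ 1) ∧ (∀ y, |G y| ≤ c * (M - L)) ∧
      ∀ y, M < |y| → |G y| = c * (M - L) := by
  obtain ⟨C, hC, hCb⟩ := exists_deriv_smoothTransition_le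
  -- The factor 1 / C offsets the maximal slope of the transition function; the plateau then has
  -- height c (M - L) instead of M - L, which is harmless.
  refine ⟨1 / C, by positivity, fun L M hL hLM => ?_⟩
  have hd : 0 < M - L := sub_pos.2 hLM
  set S := Real.smoothTransition with hS
  have hSc : ContDiff ℝ ∞ S := Real.smoothTransition.contDiff
  have hSd : Differentiable ℝ S := hSc.differentiable (by simp)
  have hS0 : ∀ y, 0 ≤ deriv S y := fun y => Real.smoothTransition.monotone.deriv_nonneg
  -- Each such y is a minimum point of S, which also covers the endpoint y = 0.
  have hSz : ∀ y ≤ 0, deriv S y = 0 := by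
    intro y hy
    have : IsLocalMin S y := Eventually.of_forall fun z => by
      rw [hS, Real.smoothTransition.zero_of_nonpos hy]; exact Real.smoothTransition.nonneg z
    exact this.deriv_eq_zero
  set G : ℝ → ℝ := fun y => 1 / C * (M - L) * (S ((y - L) / (M - L)) - S ((-y - L) / (M - L)))
  have hder : ∀ y, HasDerivAt G
      (1 / C * (deriv S ((y - L) / (M - L)) + deriv S ((-y - L) / (M - L)))) y := by
    intro y
    have h1 : HasDerivAt (fun y : ℝ => (y - L) / (M - L)) (1 / (M - L)) y :=
      ((hasDerivAt_id y).sub_const L).div_const _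
    have h2 : HasDerivAt (fun y : ℝ => (-y - L) / (M - L)) (-1 / (M - L)) y :=
      ((hasDerivAt_id y).neg.sub_const L).div_const _
    have h3 := (((hSd _).hasDerivAt.comp y h1).sub ((hSd _).hasDerivAt.comp y h2)).const_mul
      (1 / C * (M - L))
    refine h3.congr_deriv ?_
    have := hd.ne'
    field_simp
    ring
  have hneg1 : ∀ y, y ≤ L → (y - L) / (M - L) ≤ 0 := fun y hy =>
    div_nonpos_of_nonpos_of_nonneg (by linarith) hd.le
  refine ⟨G, ?_, fun y hy => ?_, fun y => ?_, fun y => ?_, fun y hy => ?_⟩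
  · refine contDiff_const.mul ((hSc.comp ?_).sub (hSc.comp ?_))
    · exact (contDiff_id.sub contDiff_const).div_const _
    · exact (contDiff_neg.sub contDiff_const).div_const _
  · have h1 := hneg1 y (abs_le.1 hy).2
    have h2 := hneg1 (-y) (by linarith [(abs_le.1 hy).1])
    rw [(hder y).deriv, hSz _ h1, hSz _ h2]
    refine ⟨?_, by simp⟩
    simp only [G, hS, Real.smoothTransition.zero_of_nonpos h1,
      Real.smoothTransition.zero_of_nonpos h2]
    simp
  · rw [(hder y).deriv]
    have hb : ∀ z, deriv S z ≤ C := fun z => (le_abs_self _).trans (hCb z)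
    refine ⟨mul_nonneg (by positivity) (add_nonneg (hS0 _) (hS0 _)), ?_⟩
    rw [one_div, inv_mul_le_iff₀ hC, mul_one]
    -- Since L > 0, at most one of the two transitions has nonzero slope at y.
    rcases le_total 0 y with h0 | h0
    · rw [hSz ((-y - L) / (M - L)) (hneg1 (-y) (by linarith)), add_zero]
      exact hb _
    · rw [hSz ((y - L) / (M - L)) (hneg1 y (by linarith)), zero_add]
      exact hb _
  · have hp : 0 ≤ 1 / C * (M - L) := by positivity
    simp only [G]
    rw [abs_mul, abs_of_nonneg hp]
    refine mul_le_of_le_one_right hp ?_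
    rw [abs_le]
    have a1 := Real.smoothTransition.nonneg ((y - L) / (M - L))
    have a2 := Real.smoothTransition.nonneg ((-y - L) / (M - L))
    have a3 := Real.smoothTransition.le_one ((y - L) / (M - L))
    have a4 := Real.smoothTransition.le_one ((-y - L) / (M - L))
    constructor <;> linarith
  · have hp : 0 ≤ 1 / C * (M - L) := by positivity
    simp only [G]
    rw [abs_mul, abs_of_nonneg hp]
    suffices |S ((y - L) / (M - L)) - S ((-y - L) / (M - L))| = 1 by rw [this, mul_one]
    have hone : ∀ z, M < z → 1 ≤ (z - L) / (M - L) := fun z hz => by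
      rw [le_div_iff₀ hd]; linarith
    rcases lt_abs.1 hy with h1 | h1
    · rw [hS, Real.smoothTransition.one_of_one_le (hone y h1),
        Real.smoothTransition.zero_of_nonpos (hneg1 (-y) (by linarith))]
      simp
    · rw [hS, Real.smoothTransition.one_of_one_le (hone (-y) h1),
        Real.smoothTransition.zero_of_nonpos (hneg1 y (by linarith))]
      simp

/-! ### Gagliardo's method and the Loomis–Whitney inequality -/

theorem prod_rpow_eq_rpow_sum {ι : Type*} (S : Finset ι) (a : ℝ≥0∞) {f : ι → ℝ}
    (hf : ∀ i ∈ S, 0 ≤ f i) : ∏ i ∈ S, a ^ f i = a ^ ∑ i ∈ S, f i := by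
  classical
  induction S using Finset.induction_on with
  | empty => simp
  | insert i S hi ih =>
    rw [Finset.prod_insert hi, Finset.sum_insert hi,
      ih fun j hj => hf j (Finset.mem_insert_of_mem hj),
      ENNReal.rpow_add_of_nonneg _ _ (hf i (Finset.mem_insert_self i S))
        (Finset.sum_nonneg fun j hj => hf j (Finset.mem_insert_of_mem hj))]

/-- The fundamental theorem of calculus along the j-th coordinate line, starting where ψ vanishes.
-/
theorem enorm_le_lintegral_partialDeriv {ψ : Pt n → ℝ} (hψ : ContDiff ℝ 1 ψ)
    (hc : HasCompactSupport ψ) (j : Fin n) (x : Pt n) :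
    ‖ψ x‖ₑ ≤ ∫⁻ t, ‖partialDeriv j ψ (Function.update x j t)‖ₑ := by
  calc ‖ψ x‖ₑ
    _ ≤ ∫⁻ t in Set.Iic (x j), ‖deriv (ψ ∘ Function.update x j) t‖ₑ := by
        apply le_trans (by simp) (HasCompactSupport.enorm_le_lintegral_Ici_deriv _ _ _)
        · exact hψ.comp (by convert! contDiff_update 1 x j)
        · exact hc.comp_isClosedEmbedding (isClosedEmbedding_update x j)
    _ ≤ ∫⁻ t, ‖deriv (ψ ∘ Function.update x j) t‖ₑ :=
        lintegral_mono' Measure.restrict_le_self le_rfl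
    _ = ∫⁻ t, ‖partialDeriv j ψ (Function.update x j t)‖ₑ := by
        refine lintegral_congr fun t => ?_
        rw [fderiv_comp_deriv _ (hψ.differentiable one_ne_zero).differentiableAt
          (hasDerivAt_update x j t).differentiableAt, deriv_update]
        rfl

/-- The Loomis–Whitney inequality for a family of functions, with a non-sharp constant. -/
theorem lintegral_prod_lintegral_rpow_le (hn : 2 ≤ n) {f : Fin n → Pt n → ℝ≥0∞}
    (hf : ∀ i, Measurable (f i)) {B : Fin n → ℝ≥0∞} (hB0 : ∀ i, B i ≠ 0) (hB : ∀ i, B i ≠ ⊤)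
    (hfB : ∀ i, ∫⁻ x, f i x ≤ B i) :
    ∫⁻ x, ∏ i, (∫⁻ t, f i (Function.update x i t)) ^ (1 / ((n : ℝ) - 1)) ≤
      (n : ℝ≥0∞) ^ ((n : ℝ) / (n - 1)) * ∏ i, B i ^ (1 / ((n : ℝ) - 1)) := by
  have hn' : (2 : ℝ) ≤ n := by exact_mod_cast hn
  have he : 0 ≤ 1 / ((n : ℝ) - 1) := by
    apply div_nonneg zero_le_one; linarith
  set e := 1 / ((n : ℝ) - 1)
  -- The inequality for a single function is applied to this normalised sum: its integral is at most
  -- n, and B i * F dominates f i. The price is the factor n^{n/(n-1)}.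
  set F : Pt n → ℝ≥0∞ := fun x => ∑ i, (B i)⁻¹ * f i x
  have hF : Measurable F := Finset.measurable_sum _ fun i _ => (hf i).const_mul _
  have hFint : ∫⁻ x, F x ≤ n := by
    simp only [F]
    rw [lintegral_finsetSum _ fun i _ => (hf i).const_mul _]
    calc ∑ i, ∫⁻ x, (B i)⁻¹ * f i x ≤ ∑ _i : Fin n, (1 : ℝ≥0∞) := by
          refine Finset.sum_le_sum fun i _ => ?_
          rw [lintegral_const_mul _ (hf i), ← ENNReal.inv_mul_cancel (hB0 i) (hB i)]
          gcongr
          exact hfB i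
      _ = n := by simp
  have hconj : Real.HolderConjugate (Fintype.card (Fin n)) ((n : ℝ) / (n - 1)) := by
    rw [Fintype.card_fin]
    exact Real.HolderConjugate.conjExponent (by linarith)
  have key := lintegral_prod_lintegral_pow_le (fun _ : Fin n => (volume : Measure ℝ)) hconj hF
  rw [Fintype.card_fin] at key
  have hmono : ∀ x i, f i x ≤ B i * F x := fun x i => by
    calc f i x = B i * ((B i)⁻¹ * f i x) := by
          rw [← mul_assoc, ENNReal.mul_inv_cancel (hB0 i) (hB i), one_mul]
      _ ≤ B i * F x := by
          gcongr
          exact Finset.single_le_sum (f := fun i => (B i)⁻¹ * f i x) (fun _ _ => zero_le)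
            (Finset.mem_univ i)
  calc ∫⁻ x, ∏ i, (∫⁻ t, f i (Function.update x i t)) ^ e
      ≤ ∫⁻ x, (∏ i, B i ^ e) * ∏ i, (∫⁻ t, F (Function.update x i t)) ^ e := by
        refine lintegral_mono fun x => ?_
        rw [← Finset.prod_mul_distrib]
        refine Finset.prod_le_prod' fun i _ => ?_
        rw [← ENNReal.mul_rpow_of_nonneg _ _ he]
        refine ENNReal.rpow_le_rpow ?_ he
        rw [← lintegral_const_mul' _ _ (hB i)]
        exact lintegral_mono fun t => hmono _ i
    _ = (∏ i, B i ^ e) * ∫⁻ x, ∏ i, (∫⁻ t, F (Function.update x i t)) ^ e :=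
        lintegral_const_mul' _ _
          (ENNReal.prod_ne_top fun i _ => ENNReal.rpow_ne_top_of_nonneg he (hB i))
    _ ≤ (∏ i, B i ^ e) * (n : ℝ≥0∞) ^ ((n : ℝ) / (n - 1)) := by
        gcongr
        refine key.trans ?_
        refine ENNReal.rpow_le_rpow hFint (div_nonneg (by linarith) (by linarith))
    _ = _ := mul_comm _ _

/-- The line estimate for |φ|^γ, which is C¹ because γ > 1. -/
theorem enorm_rpow_le_lintegral {φ : Pt n → ℝ} (hφ : IsTestFunction Ω φ) {γ : ℝ} (hγ : 1 < γ)
    (j : Fin n) (x : Pt n) :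
    ‖φ x‖ₑ ^ γ ≤ ∫⁻ t, ENNReal.ofReal (γ * |φ (Function.update x j t)| ^ (γ - 1) *
      |partialDeriv j φ (Function.update x j t)|) := by
  have hsm : ContDiff ℝ 1 φ := hφ.smooth.of_le (by simp)
  have hψ : ContDiff ℝ 1 (fun x => |φ x| ^ γ) := by
    simpa using hsm.norm_rpow hγ
  have hψc : HasCompactSupport (fun x => |φ x| ^ γ) :=
    hφ.compact.comp_left (g := fun y => |y| ^ γ) (by simp [Real.zero_rpow (by linarith : γ ≠ 0)])
  have h := enorm_le_lintegral_partialDeriv hψ hψc j x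
  have hpd : ∀ y, ‖partialDeriv j (fun x => |φ x| ^ γ) y‖ₑ
      = ENNReal.ofReal (γ * |φ y| ^ (γ - 1) * |partialDeriv j φ y|) := by
    intro y
    rw [partialDeriv_comp (hsm.differentiable one_ne_zero)
      (G := fun y => |y| ^ γ) (fun y => (hasDerivAt_abs_rpow y hγ).differentiableAt),
      (hasDerivAt_abs_rpow (φ y) hγ).deriv, Real.enorm_eq_ofReal_abs, abs_mul, abs_mul, abs_mul,
      abs_of_pos (by linarith : 0 < γ), abs_of_nonneg (Real.rpow_nonneg (abs_nonneg _) _)]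
    congr 2
    rcases eq_or_ne (φ y) 0 with h0 | h0
    · simp [h0, Real.zero_rpow (by linarith : γ - 1 ≠ 0)]
    · rw [mul_assoc, ← Real.rpow_add_one (abs_ne_zero.2 h0)]
      ring_nf
  simp only [hpd] at h
  refine le_trans (le_of_eq ?_) h
  rw [Real.enorm_eq_ofReal_abs, Real.enorm_eq_ofReal_abs,
    abs_of_nonneg (Real.rpow_nonneg (abs_nonneg _) _),
    ENNReal.ofReal_rpow_of_nonneg (abs_nonneg _) (by linarith)]

/-- The line estimates with powers γ j, each raised to 1/(n - 1), multiply to a bound for |φ|^s,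
which Loomis–Whitney integrates. -/
theorem lintegral_rpow_le_of_test (hn : 2 ≤ n) {φ : Pt n → ℝ}
    (hφ : IsTestFunction Ω φ) {γ : Fin n → ℝ} (hγ : ∀ j, 1 < γ j) {s : ℝ}
    (hs : ∑ j, γ j = (n - 1) * s) {J : Fin n → ℝ} (hJ0 : ∀ j, 0 < J j)
    (hJ : ∀ j, ∫ x in Ω, γ j * |φ x| ^ (γ j - 1) * |partialDeriv j φ x| ≤ J j) :
    ∫⁻ x in Ω, ‖φ x‖ₑ ^ s ≤
      ENNReal.ofReal ((n : ℝ) ^ ((n : ℝ) / (n - 1)) * ∏ j, J j ^ (1 / ((n : ℝ) - 1))) := by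
  have hn' : (2 : ℝ) ≤ n := by exact_mod_cast hn
  have hn1 : 0 < (n : ℝ) - 1 := by linarith
  set f : Fin n → Pt n → ℝ≥0∞ := fun j x =>
    ENNReal.ofReal (γ j * |φ x| ^ (γ j - 1) * |partialDeriv j φ x|) with hf
  have hcont : ∀ j, Continuous fun x => γ j * |φ x| ^ (γ j - 1) * |partialDeriv j φ x| := by
    intro j
    refine (continuous_const.mul ?_).mul (hφ.partialDeriv j).smooth.continuous.abs
    exact hφ.smooth.continuous.abs.rpow_const fun x => Or.inr (by linarith [hγ j])
  have hnn : ∀ j x, 0 ≤ γ j * |φ x| ^ (γ j - 1) * |partialDeriv j φ x| := fun j x => by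
    have := hγ j
    positivity
  have hsupp : ∀ j x, x ∉ Ω → γ j * |φ x| ^ (γ j - 1) * |partialDeriv j φ x| = 0 :=
    fun j x hx => by rw [(hφ.partialDeriv j).eq_zero_of_notMem hx]; simp
  have hint : ∀ j, Integrable fun x => γ j * |φ x| ^ (γ j - 1) * |partialDeriv j φ x| := fun j =>
    (hcont j).integrable_of_hasCompactSupport (hφ.partialDeriv j).compact.norm.mul_left
  have hfm : ∀ j, Measurable (f j) := fun j => (hcont j).measurable.ennreal_ofReal
  have hfJ : ∀ j, ∫⁻ x, f j x ≤ ENNReal.ofReal (J j) := by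
    intro j
    rw [hf, ← ofReal_integral_eq_lintegral_ofReal (hint j) (Eventually.of_forall (hnn j)),
      ← setIntegral_eq_integral_of_forall_compl_eq_zero (hsupp j)]
    exact ENNReal.ofReal_le_ofReal (hJ j)
  have key := lintegral_prod_lintegral_rpow_le hn hfm
    (B := fun j => ENNReal.ofReal (J j)) (fun j => by simpa using hJ0 j)
    (fun j => ENNReal.ofReal_ne_top) hfJ
  have hpt : ∀ x, ‖φ x‖ₑ ^ s
      ≤ ∏ i, (∫⁻ t, f i (Function.update x i t)) ^ (1 / ((n : ℝ) - 1)) := by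
    intro x
    calc ‖φ x‖ₑ ^ s = ∏ i, (‖φ x‖ₑ ^ γ i) ^ (1 / ((n : ℝ) - 1)) := by
          simp only [← ENNReal.rpow_mul]
          rw [prod_rpow_eq_rpow_sum, ← Finset.sum_mul, hs]
          · congr 1
            field_simp
          · intro i _
            have := hγ i
            positivity
      _ ≤ _ := by
          refine Finset.prod_le_prod' fun i _ => ENNReal.rpow_le_rpow ?_ (by positivity)
          exact enorm_rpow_le_lintegral hφ (hγ i) i x
  calc ∫⁻ x in Ω, ‖φ x‖ₑ ^ s ≤ ∫⁻ x, ‖φ x‖ₑ ^ s := setLIntegral_le_lintegral _ _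
    _ ≤ _ := lintegral_mono hpt
    _ ≤ _ := key
    _ = _ := by
      rw [ENNReal.ofReal_mul (by positivity), ENNReal.ofReal_prod_of_nonneg,
        ← ENNReal.ofReal_rpow_of_nonneg (by positivity) (by positivity), ENNReal.ofReal_natCast]
      · congr 1
        refine Finset.prod_congr rfl fun j _ => ?_
        rw [ENNReal.ofReal_rpow_of_pos (hJ0 j)]
      · intro j _
        exact Real.rpow_nonneg (hJ0 j).le _

/-- Fatou's lemma on the left. On the right, the bound B makes the weights converge boundedly, and
the strict inequality `hJ` is inherited by φ m for large m. -/
theorem IsTestLimit.lintegral_rpow_le (hn : 2 ≤ n) {w : Pt n → ℝ}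
    {g : Fin n → Pt n → ℝ} {φ : ℕ → Pt n → ℝ} (h : IsTestLimit Ω w g φ) {B : ℝ}
    (hB : ∀ m x, |φ m x| ≤ B) {γ : Fin n → ℝ} (hγ : ∀ j, 1 < γ j) {s : ℝ}
    (hs : ∑ j, γ j = (n - 1) * s) {J : Fin n → ℝ} (hJ0 : ∀ j, 0 < J j)
    (hJ : ∀ j, ∫ x in Ω, γ j * |w x| ^ (γ j - 1) * |g j x| < J j) :
    ∫⁻ x in Ω, ‖w x‖ₑ ^ s ≤
      ENNReal.ofReal ((n : ℝ) ^ ((n : ℝ) / (n - 1)) * ∏ j, J j ^ (1 / ((n : ℝ) - 1))) := by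
  have hev : ∀ j, ∀ᶠ m in atTop,
      ∫ x in Ω, γ j * |φ m x| ^ (γ j - 1) * |partialDeriv j (φ m) x| ≤ J j := by
    intro j
    have hγ0 : 0 < γ j := by linarith [hγ j]
    have hγ1 : 0 ≤ γ j - 1 := by linarith [hγ j]
    have hcm : ∀ m, Continuous fun x => γ j * |φ m x| ^ (γ j - 1) := fun m =>
      continuous_const.mul ((h.test m).smooth.continuous.abs.rpow_const fun x => Or.inr hγ1)
    have hcb : ∀ m x, |γ j * |φ m x| ^ (γ j - 1)| ≤ γ j * B ^ (γ j - 1) := by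
      intro m x
      rw [abs_of_nonneg (by positivity)]
      gcongr
      exact hB m x
    have hcae : ∀ᵐ x ∂(volume.restrict Ω), Tendsto (fun m => γ j * |φ m x| ^ (γ j - 1)) atTop
        (𝓝 (γ j * |w x| ^ (γ j - 1))) := by
      filter_upwards [h.tendsto_ae] with x hx
      exact (hx.abs.rpow_const (Or.inr hγ1)).const_mul _
    have hpm : ∀ m, Integrable (partialDeriv j (φ m)) (volume.restrict Ω) := fun m =>
      ((h.test m).partialDeriv j).integrable.integrableOn
    have hwm : AEStronglyMeasurable (fun x => γ j * |w x| ^ (γ j - 1)) (volume.restrict Ω) :=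
      aestronglyMeasurable_of_tendsto_ae atTop (fun m => (hcm m).aestronglyMeasurable) hcae
    have hwb : ∀ᵐ x ∂(volume.restrict Ω), ‖γ j * |w x| ^ (γ j - 1)‖ ≤ γ j * B ^ (γ j - 1) := by
      filter_upwards [hcae] with x hx
      exact le_of_tendsto hx.norm (Eventually.of_forall fun m => hcb m x)
    have hlim := tendsto_eLpNorm_one_mul (fun m => (hcm m).aestronglyMeasurable) hcb hcae
      (fun m => (hpm m).aestronglyMeasurable.norm) (h.integrable_deriv j).norm
      (tendsto_of_tendsto_of_tendsto_of_le_of_le tendsto_const_nhds (h.tendsto_deriv j)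
        (fun _ => zero_le) fun m => eLpNorm_mono fun x => abs_abs_sub_abs_le _ _)
    have := tendsto_integral_of_tendsto_eLpNorm_one
      (fun m => (hpm m).norm.bdd_mul (hcm m).aestronglyMeasurable
        (Eventually.of_forall (hcb m)))
      ((h.integrable_deriv j).norm.bdd_mul hwm hwb) hlim
    exact (this.eventually_lt_const (hJ j)).mono fun m hm => hm.le
  have hall := eventually_all.2 hev
  have hae : ∀ᵐ x ∂(volume.restrict Ω),
      ‖w x‖ₑ ^ s = liminf (fun m => ‖φ m x‖ₑ ^ s) atTop := by
    filter_upwards [h.tendsto_ae] with x hx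
    exact (((ENNReal.continuous_rpow_const (y := s)).tendsto _).comp hx.enorm).liminf_eq.symm
  rw [lintegral_congr_ae hae]
  refine (lintegral_liminf_le fun m => ?_).trans ?_
  · exact (h.test m).smooth.continuous.measurable.enorm.pow_const _
  · refine liminf_le_of_frequently_le' (Eventually.frequently ?_)
    filter_upwards [hall] with m hm
    exact lintegral_rpow_le_of_test hn (h.test m) hγ hs hJ0 hm

/-! ### Exponents and the anisotropic Sobolev inequality -/

theorem pBar_eq_div (p : Fin n → ℝ) : pBar p = n / ∑ k, 1 / p k := by
  rw [pBar, mul_inv, one_div, inv_inv, div_eq_mul_inv]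

theorem sum_one_div_pos (hn : 2 ≤ n) {p : Fin n → ℝ} (hp : ∀ k, 1 < p k) :
    0 < ∑ k, 1 / p k := by
  have : Nonempty (Fin n) := ⟨⟨0, by omega⟩⟩
  exact Finset.sum_pos (fun k _ => one_div_pos.2 (by linarith [hp k])) Finset.univ_nonempty

theorem one_lt_sum_one_div (hn : 2 ≤ n) {p : Fin n → ℝ} (hp : ∀ k, 1 < p k)
    (hpn : pBar p < n) : 1 < ∑ k, 1 / p k := by
  have hn' : (2 : ℝ) ≤ n := by exact_mod_cast hn
  rw [pBar_eq_div, div_lt_iff₀ (sum_one_div_pos hn hp)] at hpn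
  by_contra hc
  nlinarith

theorem pBarStar_eq_div (hn : 2 ≤ n) {p : Fin n → ℝ} (hp : ∀ k, 1 < p k)
    (hpn : pBar p < n) : pBarStar p = n / (∑ k, 1 / p k - 1) := by
  have hn' : (2 : ℝ) ≤ n := by exact_mod_cast hn
  have h1 := one_lt_sum_one_div hn hp hpn
  have h2 := sum_one_div_pos hn hp
  rw [pBarStar, pBar_eq_div]
  set σ := ∑ k, 1 / p k
  have h3 : σ - 1 ≠ 0 := by linarith
  have h4 : (n : ℝ) - n / σ ≠ 0 := by
    have : (n : ℝ) - n / σ = n * (σ - 1) / σ := by field_simp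
    rw [this]
    have : 0 < (n : ℝ) * (σ - 1) / σ := div_pos (mul_pos (by linarith) (by linarith)) h2
    exact this.ne'
  rw [div_eq_div_iff h4 h3]
  field_simp

theorem le_of_le_mul_rpow {I K α : ℝ} (hI : 0 < I) (hα : α < 1)
    (h : I ≤ K * I ^ α) : I ≤ K ^ (1 / (1 - α)) := by
  have h1 : I ^ (1 - α) ≤ K := by
    rw [Real.rpow_sub hI, Real.rpow_one, div_le_iff₀ (Real.rpow_pos_of_pos hI _)]
    exact h
  calc I = (I ^ (1 - α)) ^ (1 / (1 - α)) := by
        rw [← Real.rpow_mul hI.le, mul_one_div_cancel (by linarith), Real.rpow_one]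
    _ ≤ _ := Real.rpow_le_rpow (by positivity) h1 (by
        apply div_nonneg zero_le_one; linarith)

/-- **Troisi's anisotropic Sobolev inequality** for limits of bounded test functions. -/
theorem exists_anisotropic_sobolev (hn : 2 ≤ n) (hΩ : volume Ω ≠ ⊤) {p : Fin n → ℝ}
    (hp : ∀ k, 1 < p k) (hpn : pBar p < n) :
    ∃ C, 0 < C ∧ ∀ (w : Pt n → ℝ) (g : Fin n → Pt n → ℝ) (φ : ℕ → Pt n → ℝ) (B Y : ℝ),
      IsTestLimit Ω w g φ → (∀ m x, |φ m x| ≤ B) → (∀ j, InLp Ω (p j) (g j)) → 0 < Y →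
      (∀ j, ∫ x in Ω, |g j x| ^ p j ≤ Y) →
      ∫ x in Ω, |w x| ^ pBarStar p ≤ C * Y ^ (pBarStar p / pBar p) := by
  have hn' : (2 : ℝ) ≤ n := by exact_mod_cast hn
  have hn1 : 0 < (n : ℝ) - 1 := by linarith
  have hσ1 := one_lt_sum_one_div hn hp hpn
  have hseq := pBarStar_eq_div hn hp hpn
  have hsp : pBarStar p / pBar p = (∑ k, 1 / p k) / (∑ k, 1 / p k - 1) := by
    rw [hseq, pBar_eq_div]
    have : ∑ k, 1 / p k - 1 ≠ 0 := by linarith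
    have : ∑ k, 1 / p k ≠ 0 := by linarith
    field_simp
  rw [hsp]
  set σ := ∑ k, 1 / p k with hσ
  set s := pBarStar p with hs
  have hs0 : 0 < s := by rw [hseq]; exact div_pos (by linarith) (by linarith)
  have hp1 : ∀ j, 0 < 1 - 1 / p j := fun j => by
    rw [sub_pos, div_lt_one (by linarith [hp j])]; exact hp j
  -- Chosen so that (γ j - 1) p_j' = s, whence Hölder reproduces ∫ |w|^s. The required value of ∑ γ
  -- j then amounts to s (σ - 1) = n, which singles out s = p̄*.
  set γ : Fin n → ℝ := fun j => 1 + s * (1 - 1 / p j) with hγdef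
  have hγ : ∀ j, 1 < γ j := fun j => by
    have := mul_pos hs0 (hp1 j)
    simp only [γ]; linarith
  have hγsum : ∑ j, γ j = (n - 1) * s := by
    simp only [γ, Finset.sum_add_distrib, ← Finset.mul_sum, Finset.sum_sub_distrib]
    simp only [Finset.sum_const, Finset.card_univ, Fintype.card_fin, nsmul_eq_mul, mul_one, ← hσ]
    have : s * (σ - 1) = n := by rw [hseq]; field_simp [(by linarith : σ - 1 ≠ 0)]
    linarith
  set e := 1 / ((n : ℝ) - 1) with he
  have he0 : 0 < e := by positivity
  set A : ℝ := (n : ℝ) ^ ((n : ℝ) / (n - 1)) * ∏ j, (2 * γ j) ^ e with hA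
  have hA0 : 0 < A := by
    refine mul_pos (by positivity) (Finset.prod_pos fun j _ => ?_)
    have := hγ j
    positivity
  refine ⟨A ^ (1 / (1 - (n - σ) * e)), by positivity, ?_⟩
  intro w g φ B Y h hB hg hY hgY
  have : IsFiniteMeasure (volume.restrict Ω) := ⟨by simpa using hΩ.lt_top⟩
  have hwB : ∀ᵐ x ∂(volume.restrict Ω), |w x| ≤ B := by
    filter_upwards [h.tendsto_ae] with x hx
    exact le_of_tendsto hx.abs (Eventually.of_forall fun m => hB m x)
  have hwm := h.integrable_fun.aestronglyMeasurable
  have hpowm : ∀ r : ℝ, AEStronglyMeasurable (fun x => |w x| ^ r) (volume.restrict Ω) := fun r =>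
    (hwm.aemeasurable.abs.pow_const r).aestronglyMeasurable
  have hpowb : ∀ r : ℝ, 0 ≤ r → ∀ᵐ x ∂(volume.restrict Ω), ‖|w x| ^ r‖ ≤ B ^ r := fun r hr => by
    filter_upwards [hwB] with x hx
    rw [Real.norm_eq_abs, abs_of_nonneg (by positivity)]
    gcongr
  have hwint : Integrable (fun x => |w x| ^ s) (volume.restrict Ω) :=
    Integrable.of_bound (hpowm s) (B ^ s) (hpowb s hs0.le)
  set I := ∫ x in Ω, |w x| ^ s with hI
  have hI0 : 0 ≤ I := integral_nonneg fun x => by positivity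
  rcases hI0.eq_or_lt with hI0 | hI0
  · rw [← hI0]; positivity
  -- The factor 2 makes the bound `hJ` strict.
  set J : Fin n → ℝ := fun j => 2 * γ j * (I ^ (1 - 1 / p j) * Y ^ (1 / p j)) with hJdef
  have hJ0 : ∀ j, 0 < J j := fun j => by
    have := hγ j
    simp only [J]; positivity
  have hJ : ∀ j, ∫ x in Ω, γ j * |w x| ^ (γ j - 1) * |g j x| < J j := by
    intro j
    have hpj := hp j
    have hconj : (p j / (p j - 1)).HolderConjugate (p j) :=
      (Real.HolderConjugate.conjExponent hpj).symm
    have hγ1 : 0 ≤ γ j - 1 := by linarith [hγ j]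
    have hm1 : MemLp (fun x => |w x| ^ (γ j - 1)) (ENNReal.ofReal (p j / (p j - 1)))
        (volume.restrict Ω) := MemLp.of_bound (hpowm _) _ (hpowb _ hγ1)
    have hH := integral_mul_le_Lp_mul_Lq_of_nonneg (μ := volume.restrict Ω) hconj
      (f := fun x => |w x| ^ (γ j - 1)) (g := fun x => |g j x|)
      (Eventually.of_forall fun x => by positivity)
      (Eventually.of_forall fun x => abs_nonneg _) hm1 (hg j).norm
    have hexp : ∀ x, (|w x| ^ (γ j - 1)) ^ (p j / (p j - 1)) = |w x| ^ s := by
      intro x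
      rw [← Real.rpow_mul (abs_nonneg _)]
      congr 1
      have : p j - 1 ≠ 0 := by linarith
      simp only [γ]
      field_simp
      ring
    simp only [hexp] at hH
    have hinv : 1 / (p j / (p j - 1)) = 1 - 1 / p j := by
      field_simp
    rw [hinv, ← hI] at hH
    have hH2 : ∫ x in Ω, |w x| ^ (γ j - 1) * |g j x| ≤ I ^ (1 - 1 / p j) * Y ^ (1 / p j) := by
      refine hH.trans ?_
      gcongr
      exact hgY j
    simp only [mul_assoc, J]
    rw [integral_const_mul]
    have hpos : 0 < γ j * (I ^ (1 - 1 / p j) * Y ^ (1 / p j)) := by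
      have := hγ j
      positivity
    have := mul_le_mul_of_nonneg_left hH2 (by linarith [hγ j] : 0 ≤ γ j)
    linarith
  have key := h.lintegral_rpow_le hn hB hγ hγsum hJ0 hJ
  have hkey : I ≤ (n : ℝ) ^ ((n : ℝ) / (n - 1)) * ∏ j, J j ^ e := by
    have hnn : 0 ≤ (n : ℝ) ^ ((n : ℝ) / (n - 1)) * ∏ j, J j ^ e :=
      mul_nonneg (by positivity) (Finset.prod_nonneg fun j _ => Real.rpow_nonneg (hJ0 j).le _)
    rw [← ENNReal.ofReal_le_ofReal_iff hnn]
    refine le_trans (le_of_eq ?_) key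
    rw [hI, ofReal_integral_eq_lintegral_ofReal hwint
      (Eventually.of_forall fun x => by positivity)]
    refine lintegral_congr fun x => ?_
    rw [Real.enorm_eq_ofReal_abs, ENNReal.ofReal_rpow_of_nonneg (abs_nonneg _) hs0.le]
  have hprod : ∏ j, J j ^ e = (∏ j, (2 * γ j) ^ e) * (I ^ ((n - σ) * e) * Y ^ (σ * e)) := by
    have h1 : ∀ j, J j ^ e
        = (2 * γ j) ^ e * (I ^ ((1 - 1 / p j) * e) * Y ^ (1 / p j * e)) := by
      intro j
      have := hγ j
      simp only [J]
      rw [Real.mul_rpow (x := 2 * γ j) (by positivity) (by positivity),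
        Real.mul_rpow (x := I ^ (1 - 1 / p j)) (by positivity) (by positivity), ← Real.rpow_mul hI0.le,
        ← Real.rpow_mul hY.le]
    simp only [h1, Finset.prod_mul_distrib]
    rw [← Real.rpow_sum_of_pos hI0, ← Real.rpow_sum_of_pos hY, ← Finset.sum_mul, ← Finset.sum_mul,
      Finset.sum_sub_distrib]
    simp [hσ]
  rw [hprod] at hkey
  -- The power of I on the right is (n - σ)/(n - 1), less than 1 because σ > 1, so it can be
  -- absorbed.
  have hfin := le_of_le_mul_rpow (K := A * Y ^ (σ * e)) (α := (n - σ) * e) hI0 (by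
      rw [he, mul_one_div, div_lt_one hn1]; linarith) (by
      refine hkey.trans (le_of_eq ?_)
      rw [hA]; ring)
  refine hfin.trans (le_of_eq ?_)
  rw [Real.mul_rpow hA0.le (by positivity), ← Real.rpow_mul hY.le]
  congr 2
  have h3 : σ - 1 ≠ 0 := by linarith
  have h4 : 1 - (n - σ) * e = (σ - 1) * e := by
    rw [he]; field_simp; ring
  rw [h4]
  field_simp

/-! ### Nemytskii operators on Lebesgue spaces -/

/-- For simple z the composition is a finite sum of indicators of measurable functions; continuity
in z carries measurability to the limit. -/
theorem IsCaratheodory.aestronglyMeasurable_comp {a : Pt n → Pt n → ℝ}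
    (ha : IsCaratheodory Ω a) {z : Pt n → Pt n}
    (hz : AEStronglyMeasurable z (volume.restrict Ω)) :
    AEStronglyMeasurable (fun x => a x (z x)) (volume.restrict Ω) := by
  have hsm := hz.stronglyMeasurable_mk
  have h1 : AEStronglyMeasurable (fun x => a x (hz.mk z x)) (volume.restrict Ω) := by
    refine aestronglyMeasurable_of_tendsto_ae atTop (f := fun m x => a x (hsm.approx m x))
      (fun m => ?_) ?_
    · have e : (fun x => a x (hsm.approx m x)) = ∑ y ∈ (hsm.approx m).range,
          (hsm.approx m ⁻¹' {y}).indicator (fun x => a x y) := by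
        ext x
        rw [Finset.sum_apply, Finset.sum_eq_single (hsm.approx m x)]
        · simp
        · intro y _ hy
          have hy' : x ∉ hsm.approx m ⁻¹' {y} := fun h => hy (Set.mem_singleton_iff.1 h).symm
          exact Set.indicator_of_notMem hy' _
        · intro h
          exact absurd (SimpleFunc.mem_range_self _ x) h
      rw [e]
      exact Finset.aestronglyMeasurable_sum _ fun y _ =>
        (ha.meas y).indicator ((hsm.approx m).measurableSet_fiber y)
    · filter_upwards [ha.cont] with x hx
      exact (hx.tendsto _).comp (hsm.tendsto_approx x)
  refine h1.congr ?_
  filter_upwards [hz.ae_eq_mk] with x hx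
  rw [hx]

theorem aestronglyMeasurable_pi {z : Fin n → Pt n → ℝ} {μ : Measure (Pt n)}
    (hz : ∀ j, AEStronglyMeasurable (z j) μ) :
    AEStronglyMeasurable (fun x j => z j x) μ :=
  (aemeasurable_pi_lambda _ fun j => (hz j).aemeasurable).aestronglyMeasurable

theorem InLp.abs_rpow {f : Pt n → ℝ} {r α : ℝ} (hf : InLp Ω r f) (hα : 0 < α) :
    InLp Ω (r / α) (fun x => |f x| ^ α) := by
  have := MemLp.norm_rpow_div hf (ENNReal.ofReal α)
  rw [ENNReal.toReal_ofReal hα.le, ← ENNReal.ofReal_div_of_pos hα] at this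
  exact this

theorem InLp.mono_exponent (hΩ : volume Ω ≠ ⊤) {f : Pt n → ℝ} {r r' : ℝ} (hf : InLp Ω r f)
    (h : r' ≤ r) : InLp Ω r' f := by
  have : IsFiniteMeasure (volume.restrict Ω) := ⟨by simpa using hΩ.lt_top⟩
  exact MemLp.mono_exponent hf (ENNReal.ofReal_le_ofReal h)

theorem InLp.integrable_abs_rpow {f : Pt n → ℝ} {r : ℝ} (hf : InLp Ω r f) (hr : 0 < r) :
    Integrable (fun x => |f x| ^ r) (volume.restrict Ω) := by
  have := hf.abs_rpow hr
  rw [div_self hr.ne'] at this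
  exact this.integrable

theorem InLp.integrable_mul {f g : Pt n → ℝ} {p : ℝ} (hp : 1 < p) (hf : InLp Ω (p / (p - 1)) f)
    (hg : InLp Ω p g) : Integrable (fun x => f x * g x) (volume.restrict Ω) := by
  have h1 : (p / (p - 1)).HolderConjugate p := (Real.HolderConjugate.conjExponent hp).symm
  have := h1.ennrealOfReal
  exact MemLp.integrable_mul hf hg

/-- A Nemytskii operator subject to the growth condition maps `∏ L^{ρ p_j}` to
`L^{ρ / (1 - 1 / p_i)}`. -/
theorem inLp_of_growth {p : Fin n → ℝ} (hp : ∀ k, 1 < p k) {a : Pt n → Pt n → ℝ}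
    (ha : IsCaratheodory Ω a) {h : Pt n → ℝ} {c α : ℝ} (hα : 0 < α)
    (hgrowth : ∀ᵐ x ∂(volume.restrict Ω), ∀ z : Pt n,
      |a x z| ≤ c * (h x + ∑ j, |z j| ^ p j) ^ α)
    (hh0 : ∀ᵐ x ∂(volume.restrict Ω), 0 ≤ h x) {ρ : ℝ} (hh : InLp Ω ρ h)
    {z : Fin n → Pt n → ℝ} (hz : ∀ j, InLp Ω (ρ * p j) (z j)) :
    InLp Ω (ρ / α) (fun x => a x (fun j => z j x)) := by
  have hsum : InLp Ω ρ (fun x => h x + ∑ j, |z j x| ^ p j) := by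
    refine MemLp.add hh (memLp_finsetSum _ fun j _ => ?_)
    have := (hz j).abs_rpow (by linarith [hp j] : 0 < p j)
    rwa [mul_div_cancel_right₀ _ (by linarith [hp j] : p j ≠ 0)] at this
  have hpow := (hsum.abs_rpow hα).const_mul c
  refine hpow.mono (ha.aestronglyMeasurable_comp
    (aestronglyMeasurable_pi fun j => (hz j).aestronglyMeasurable)) ?_
  filter_upwards [hgrowth, hh0] with x hx hx0
  have hnn : 0 ≤ h x + ∑ j, |z j x| ^ p j :=
    add_nonneg hx0 (Finset.sum_nonneg fun j _ => by positivity)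
  refine (hx fun j => z j x).trans ?_
  rw [abs_of_nonneg hnn]
  exact le_abs_self _

/-! ### Energy estimates and decay of distribution functions -/

/-- Young's inequality with a small constant in front of one term. -/
theorem exists_young {p ε : ℝ} (hp : 1 < p) (hε : 0 < ε) :
    ∃ K, 0 < K ∧ ∀ g d : ℝ, g * d ≤ K * |g| ^ (p / (p - 1)) + ε * |d| ^ p := by
  have hp0 : 0 < p := by linarith
  have hconj : (p / (p - 1)).HolderConjugate p := (Real.HolderConjugate.conjExponent hp).symm
  -- Young's inequality is applied to the product (g / δ)(δ d), and δ ^ p = ε.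
  set δ := ε ^ (1 / p) with hδ
  have hδ0 : 0 < δ := Real.rpow_pos_of_pos hε _
  refine ⟨(1 / δ) ^ (p / (p - 1)), by positivity, fun g d => ?_⟩
  have h := Real.young_inequality (1 / δ * g) (δ * d) hconj
  have e1 : 1 / δ * g * (δ * d) = g * d := by field_simp
  rw [e1, abs_mul, abs_mul, abs_of_pos hδ0, abs_of_pos (by positivity : 0 < 1 / δ),
    Real.mul_rpow (by positivity) (abs_nonneg _), Real.mul_rpow hδ0.le (abs_nonneg _)] at h
  have e2 : δ ^ p = ε := by
    rw [hδ, ← Real.rpow_mul hε.le, one_div_mul_cancel hp0.ne', Real.rpow_one]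
  rw [e2] at h
  refine h.trans (add_le_add ?_ ?_)
  · exact div_le_self (by positivity) hconj.lt.le
  · exact div_le_self (by positivity) hp.le

/-- Hölder's inequality against a function with values in `[0, 1]` vanishing outside `A`. -/
theorem integral_mul_abs_rpow_le {g χ : Pt n → ℝ} {r t : ℝ} (ht : 0 < t) (htr : t < r)
    (hΩ : volume Ω ≠ ⊤)
    (hg : InLp Ω r g) (hχm : AEStronglyMeasurable χ (volume.restrict Ω))
    (hχ0 : ∀ x, 0 ≤ χ x) (hχ1 : ∀ x, χ x ≤ 1) {A : Set (Pt n)}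
    (hA : NullMeasurableSet A (volume.restrict Ω)) (hχA : ∀ x, x ∉ A → χ x = 0) :
    ∫ x in Ω, χ x * |g x| ^ t ≤
      (∫ x in Ω, |g x| ^ r) ^ (t / r) * ((volume.restrict Ω).real A) ^ (1 - t / r) := by
  have : IsFiniteMeasure (volume.restrict Ω) := ⟨by simpa using hΩ.lt_top⟩
  have hr : 0 < r := ht.trans htr
  have h1 : 1 < r / t := (one_lt_div ht).2 htr
  have hconj := Real.HolderConjugate.conjExponent h1
  set m := (r / t).conjExponent with hm
  have hm1 : 1 / m = 1 - t / r := by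
    have := hconj.one_div_eq
    rw [one_div_div] at this
    linarith
  have hχL : MemLp χ (ENNReal.ofReal m) (volume.restrict Ω) :=
    MemLp.of_bound hχm 1 (Eventually.of_forall fun x => by
      rw [Real.norm_eq_abs, abs_of_nonneg (hχ0 x)]; exact hχ1 x)
  have hH := integral_mul_le_Lp_mul_Lq_of_nonneg (μ := volume.restrict Ω) hconj
      (f := fun x => |g x| ^ t) (g := χ)
      (Eventually.of_forall fun x => by positivity)
      (Eventually.of_forall hχ0) (hg.abs_rpow ht) hχL
  have e1 : ∀ x, (|g x| ^ t) ^ (r / t) = |g x| ^ r := fun x => by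
    rw [← Real.rpow_mul (abs_nonneg _), mul_div_cancel₀ _ ht.ne']
  have e2 : 1 / (r / t) = t / r := by rw [one_div_div]
  simp only [e1, e2, hm1] at hH
  simp only [mul_comm (χ _)]
  refine hH.trans ?_
  gcongr
  · exact integral_nonneg fun x => Real.rpow_nonneg (hχ0 x) _
  · rw [sub_nonneg, div_le_one hr]; exact htr.le
  · have hmeas : (volume.restrict Ω).real A = ∫ x in Ω, A.indicator (fun _ => (1 : ℝ)) x := by
      rw [integral_indicator₀ hA, setIntegral_const, smul_eq_mul, mul_one]
    rw [hmeas]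
    refine integral_mono_of_nonneg (Eventually.of_forall fun x => Real.rpow_nonneg (hχ0 x) _)
      ((integrable_const (1 : ℝ)).indicator₀ hA) (Eventually.of_forall fun x => ?_)
    by_cases hx : x ∈ A
    · simp only [Set.indicator_of_mem hx]
      exact Real.rpow_le_one (hχ0 x) (hχ1 x) hconj.symm.nonneg
    · simp only [Set.indicator_of_notMem hx, hχA x hx]
      rw [Real.zero_rpow hconj.symm.ne_zero]

theorem InLp.bdd_mul {d χ : Pt n → ℝ} {r : ℝ} (hd : InLp Ω r d)
    (hχm : AEStronglyMeasurable χ (volume.restrict Ω)) (hχ0 : ∀ x, 0 ≤ χ x)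
    (hχ1 : ∀ x, χ x ≤ 1) : InLp Ω r (fun x => χ x * d x) := by
  refine MemLp.mono hd (hχm.mul hd.aestronglyMeasurable) (Eventually.of_forall fun x => ?_)
  rw [norm_mul, Real.norm_eq_abs, abs_of_nonneg (hχ0 x)]
  exact mul_le_of_le_one_left (norm_nonneg _) (hχ1 x)

/-- The weighted energy estimate: coercivity, the equation tested with `χ d`, and Young's
inequality. -/
theorem exists_weighted_energy_bound {p : Fin n → ℝ} (hp : ∀ k, 1 < p k) {ν : ℝ} (hν : 0 < ν) :
    ∃ K : Fin n → ℝ, (∀ i, 0 < K i) ∧ ∀ (A E f d : Fin n → Pt n → ℝ) (χ : Pt n → ℝ),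
      (∀ i, InLp Ω (p i / (p i - 1)) (A i)) → (∀ i, InLp Ω (p i / (p i - 1)) (E i)) →
      (∀ i, InLp Ω (p i / (p i - 1)) (f i)) → (∀ i, InLp Ω (p i) (d i)) →
      AEStronglyMeasurable χ (volume.restrict Ω) → (∀ x, 0 ≤ χ x) → (∀ x, χ x ≤ 1) →
      (∀ᵐ x ∂(volume.restrict Ω), ν * ∑ i, |d i x| ^ p i ≤ ∑ i, (A i x - E i x) * d i x) →
      ∫ x in Ω, ∑ i, A i x * (χ x * d i x) = ∫ x in Ω, ∑ i, f i x * (χ x * d i x) →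
      ν / 2 * ∑ i, ∫ x in Ω, χ x * |d i x| ^ p i ≤
        ∑ i, K i * ∫ x in Ω, χ x * |f i x - E i x| ^ (p i / (p i - 1)) := by
  choose K hK0 hK using fun i => exists_young (hp i) (half_pos hν)
  refine ⟨K, hK0, ?_⟩
  intro A E f d χ hA hE hf hd hχm hχ0 hχ1 hmono heq
  have hχd := fun i => (hd i).bdd_mul hχm hχ0 hχ1
  have hχb : ∀ᵐ x ∂(volume.restrict Ω), ‖χ x‖ ≤ 1 := Eventually.of_forall fun x => by
    rw [Real.norm_eq_abs, abs_of_nonneg (hχ0 x)]; exact hχ1 x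
  have hp' : ∀ i, 0 < p i / (p i - 1) := fun i =>
    div_pos (by linarith [hp i]) (by linarith [hp i])
  have i1 : ∀ i, Integrable (fun x => χ x * |d i x| ^ p i) (volume.restrict Ω) := fun i =>
    ((hd i).integrable_abs_rpow (by linarith [hp i])).bdd_mul hχm hχb
  have i2 : ∀ i, Integrable (fun x => χ x * |f i x - E i x| ^ (p i / (p i - 1)))
      (volume.restrict Ω) := fun i => by
    have : InLp Ω (p i / (p i - 1)) (fun x => f i x - E i x) := (hf i).sub (hE i)
    exact (this.integrable_abs_rpow (hp' i)).bdd_mul hχm hχb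
  have i3 : Integrable (fun x => ∑ i, A i x * (χ x * d i x)) (volume.restrict Ω) :=
    integrable_finsetSum _ fun i _ => (hA i).integrable_mul (hp i) (hχd i)
  have i4 : Integrable (fun x => ∑ i, f i x * (χ x * d i x)) (volume.restrict Ω) :=
    integrable_finsetSum _ fun i _ => (hf i).integrable_mul (hp i) (hχd i)
  have i5 : Integrable (fun x => ∑ i, ν / 2 * (χ x * |d i x| ^ p i)) (volume.restrict Ω) :=
    integrable_finsetSum _ fun i _ => (i1 i).const_mul _
  have i6 : Integrable (fun x => ∑ i, K i * (χ x * |f i x - E i x| ^ (p i / (p i - 1))))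
      (volume.restrict Ω) := integrable_finsetSum _ fun i _ => (i2 i).const_mul _
  have hle : (fun x => ∑ i, ν / 2 * (χ x * |d i x| ^ p i) -
      ∑ i, K i * (χ x * |f i x - E i x| ^ (p i / (p i - 1)))) ≤ᵐ[volume.restrict Ω]
      fun x => ∑ i, A i x * (χ x * d i x) - ∑ i, f i x * (χ x * d i x) := by
    filter_upwards [hmono] with x hx
    have h1 := mul_le_mul_of_nonneg_left hx (hχ0 x)
    have h2 : ∑ i, χ x * ((f i x - E i x) * d i x) ≤ ∑ i, χ x *
        (K i * |f i x - E i x| ^ (p i / (p i - 1)) + ν / 2 * |d i x| ^ p i) :=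
      Finset.sum_le_sum fun i _ => mul_le_mul_of_nonneg_left (hK i _ _) (hχ0 x)
    rw [Finset.mul_sum, Finset.mul_sum, Finset.mul_sum] at h1
    rw [← Finset.sum_sub_distrib, ← Finset.sum_sub_distrib]
    -- In the sum of the two inequalities E cancels and A - f remains, whose weighted integral
    -- vanishes by the equation.
    rw [← sub_nonneg, ← Finset.sum_sub_distrib] at h1 h2 ⊢
    refine (add_nonneg h1 h2).trans (le_of_eq ?_)
    rw [← Finset.sum_add_distrib]
    refine Finset.sum_congr rfl fun i _ => ?_
    ring
  have hint := integral_mono_ae (i5.sub i6) (i3.sub i4) hle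
  simp only [Pi.sub_apply] at hint
  rw [integral_sub i5 i6, integral_sub i3 i4, heq, sub_self,
    integral_finsetSum _ fun i _ => (i1 i).const_mul _,
    integral_finsetSum _ fun i _ => (i2 i).const_mul _] at hint
  simp only [integral_const_mul] at hint
  rw [Finset.mul_sum]
  linarith

/-- Stampacchia's lemma for a sublinear power. -/
theorem exists_decay_of_doubling {φ : ℝ → ℝ} {C V s β : ℝ} (h0 : ∀ L, 0 ≤ φ L)
    (hV : ∀ L, φ L ≤ V) (hC : 0 < C) (hs : 0 < s) (hβ0 : 0 ≤ β) (hβ : β < 1)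
    (h : ∀ L, 0 < L → φ (2 * L) ≤ C / L ^ s * φ L ^ β) :
    ∃ K, 0 < K ∧ ∀ L, 0 < L → φ L ≤ K / L ^ (s / (1 - β)) := by
  have hβ' : 0 < 1 - β := by linarith
  set t := s / (1 - β) with ht
  have ht0 : 0 < t := div_pos hs hβ'
  have hst : s + t * β = t := by
    rw [ht]; field_simp; ring
  set C' := C * 2 ^ t with hC'
  have hC'0 : 0 < C' := by positivity
  -- The first entry handles L ≤ 1; the second gives C' K^β ≤ K, so the constant reproduces itself
  -- when L is doubled.
  set K := max V (C' ^ (1 / (1 - β))) with hK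
  have hK0 : 0 < K := lt_of_lt_of_le (by positivity) (le_max_right _ _)
  have hKC : C' * K ^ β ≤ K := by
    have h1 : C' ≤ K ^ (1 - β) := by
      calc C' = (C' ^ (1 / (1 - β))) ^ (1 - β) := by
            rw [← Real.rpow_mul hC'0.le, one_div_mul_cancel hβ'.ne', Real.rpow_one]
        _ ≤ _ := Real.rpow_le_rpow (by positivity) (le_max_right _ _) hβ'.le
    calc C' * K ^ β ≤ K ^ (1 - β) * K ^ β := by gcongr
      _ = K := by rw [← Real.rpow_add hK0]; simp
  have hmain : ∀ N : ℕ, ∀ L, 0 < L → L ≤ 2 ^ N → φ L ≤ K / L ^ t := by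
    intro N
    induction N with
    | zero =>
      intro L hL hL1
      have h1 : L ^ t ≤ 1 := Real.rpow_le_one hL.le (by simpa using hL1) ht0.le
      rw [le_div_iff₀ (by positivity)]
      calc φ L * L ^ t ≤ φ L * 1 := mul_le_mul_of_nonneg_left h1 (h0 L)
        _ ≤ K := by rw [mul_one]; exact (hV L).trans (le_max_left _ _)
    | succ N ih =>
      intro L hL hL1
      have hl : 0 < L / 2 := by positivity
      have hi := ih (L / 2) hl (by rw [pow_succ] at hL1; linarith)
      have h2 := h (L / 2) hl
      rw [mul_div_cancel₀ L two_ne_zero] at h2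
      calc φ L ≤ C / (L / 2) ^ s * φ (L / 2) ^ β := h2
        _ ≤ C / (L / 2) ^ s * (K / (L / 2) ^ t) ^ β := by
            gcongr
            exact h0 _
        _ = C * K ^ β / (L / 2) ^ t := by
            rw [Real.div_rpow hK0.le (by positivity), ← Real.rpow_mul hl.le, div_mul_div_comm,
              ← Real.rpow_add hl, hst]
        _ = C' * K ^ β / L ^ t := by
            rw [Real.div_rpow hL.le (by norm_num), hC']
            field_simp
        _ ≤ K / L ^ t := by gcongr
  refine ⟨K, hK0, fun L hL => ?_⟩
  obtain ⟨N, hN⟩ := pow_unbounded_of_one_lt L (one_lt_two (α := ℝ))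
  exact hmain N L hL hN.le

theorem le_one_sub_mul_of_le_iInf {p q : Fin n → ℝ} (hp : ∀ k, 1 < p k)
    (hpq : ∀ k, p k < q k) {b : ℝ}
    (hb : b ≤ (⨅ j, (1 - p j / q j)) * ⨅ i, (1 - 1 / p i)) (i j : Fin n) :
    b ≤ (1 - p j / q j) * (1 - 1 / p i) := by
  have : Nonempty (Fin n) := ⟨i⟩
  have h1 : ∀ j, 0 ≤ 1 - p j / q j := fun j => by
    have := hp j; have := hpq j
    rw [sub_nonneg, div_le_one (by linarith)]; linarith
  have h2 : ∀ i, 0 ≤ 1 - 1 / p i := fun i => by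
    have := hp i
    rw [sub_nonneg, div_le_one (by linarith)]; linarith
  exact hb.trans (mul_le_mul (ciInf_le (Set.finite_range _).bddBelow j)
    (ciInf_le (Set.finite_range _).bddBelow i) (le_ciInf h2) (h1 j))

/-- Energy estimate on superlevel sets: with data `f i - E i ∈ L^{p_i / (p_i - 1 - b p_i)}`, the
weighted energy is controlled by a power of the measure of the set where the weight lives. -/
theorem exists_energy_decay (hΩ : volume Ω ≠ ⊤) {p : Fin n → ℝ} (hp : ∀ k, 1 < p k)
    {ν : ℝ} (hν : 0 < ν) {b : ℝ} (hb0 : 0 < b) (hb : ∀ i, b < 1 - 1 / p i)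
    {A E f d : Fin n → Pt n → ℝ} (hA : ∀ i, InLp Ω (p i / (p i - 1)) (A i))
    (hE : ∀ i, InLp Ω (p i / (p i - 1 - b * p i)) (E i))
    (hf : ∀ i, InLp Ω (p i / (p i - 1 - b * p i)) (f i)) (hd : ∀ i, InLp Ω (p i) (d i))
    (hmono : ∀ᵐ x ∂(volume.restrict Ω),
      ν * ∑ i, |d i x| ^ p i ≤ ∑ i, (A i x - E i x) * d i x) :
    ∃ C, 0 < C ∧ ∀ (χ : Pt n → ℝ) (S : Set (Pt n)),
      AEStronglyMeasurable χ (volume.restrict Ω) → (∀ x, 0 ≤ χ x) → (∀ x, χ x ≤ 1) →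
      NullMeasurableSet S (volume.restrict Ω) → (∀ x, x ∉ S → χ x = 0) →
      0 < (volume.restrict Ω).real S →
      ∫ x in Ω, ∑ i, A i x * (χ x * d i x) = ∫ x in Ω, ∑ i, f i x * (χ x * d i x) →
      ∀ j, ∫ x in Ω, χ x * |d j x| ^ p j ≤
        C * (volume.restrict Ω).real S ^ (b * (pMax p / (pMax p - 1))) := by
  have : IsFiniteMeasure (volume.restrict Ω) := ⟨by simpa using hΩ.lt_top⟩
  obtain ⟨K, hK0, hK⟩ := exists_weighted_energy_bound (Ω := Ω) hp hν
  have hp1 : ∀ i, 0 < p i - 1 := fun i => by linarith [hp i]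
  have hp0 : ∀ i, 0 < p i := fun i => by linarith [hp i]
  have hD : ∀ i, 0 < p i - 1 - b * p i := fun i => by
    have := mul_lt_mul_of_pos_right (hb i) (hp0 i)
    rw [sub_mul, one_mul, one_div_mul_cancel (hp0 i).ne'] at this
    linarith
  have hlt : ∀ i, p i / (p i - 1) < p i / (p i - 1 - b * p i) := fun i =>
    div_lt_div_of_pos_left (hp0 i) (hD i) (by linarith [mul_pos hb0 (hp0 i)])
  have ht : ∀ i, 0 < p i / (p i - 1) := fun i => div_pos (hp0 i) (hp1 i)
  set W : ℝ := (volume.restrict Ω).real Set.univ + 1 with hW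
  have hW0 : 0 < W := by positivity
  set pm := pMax p / (pMax p - 1)
  -- The conjugate exponent decreases in p, so p_m gives the smallest power; the surplus powers of
  -- the measure are bounded by powers of W.
  have hpm : ∀ i, b * pm ≤ b * (p i / (p i - 1)) := fun i => by
    have h1 : p i ≤ pMax p := le_ciSup (Set.finite_range p).bddAbove i
    refine mul_le_mul_of_nonneg_left ?_ hb0.le
    rw [div_le_div_iff₀ (by linarith [hp i]) (hp1 i)]
    linarith
  set R : Fin n → ℝ := fun i =>
    (∫ x in Ω, |f i x - E i x| ^ (p i / (p i - 1 - b * p i))) ^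
      (p i / (p i - 1) / (p i / (p i - 1 - b * p i)))
  have hR0 : ∀ i, 0 ≤ R i := fun i =>
    Real.rpow_nonneg (integral_nonneg fun x => by positivity) _
  refine ⟨2 / ν * ∑ i, K i * (R i * W ^ (b * (p i / (p i - 1)) - b * pm)) + 1, ?_, ?_⟩
  · have : 0 ≤ ∑ i, K i * (R i * W ^ (b * (p i / (p i - 1)) - b * pm)) :=
      Finset.sum_nonneg fun i _ => mul_nonneg (hK0 i).le (mul_nonneg (hR0 i) (by positivity))
    positivity
  intro χ S hχm hχ0 hχ1 hS hχS hSpos heq j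
  set m := (volume.restrict Ω).real S
  have hmW : m ≤ W := by
    have : m ≤ (volume.restrict Ω).real Set.univ := measureReal_mono (Set.subset_univ S)
    linarith
  have hEn := hK A E f d χ hA (fun i => (hE i).mono_exponent hΩ (hlt i).le)
    (fun i => (hf i).mono_exponent hΩ (hlt i).le) hd hχm hχ0 hχ1 hmono heq
  have hterm : ∀ i, ∫ x in Ω, χ x * |f i x - E i x| ^ (p i / (p i - 1)) ≤
      R i * W ^ (b * (p i / (p i - 1)) - b * pm) * m ^ (b * pm) := by
    intro i
    have hg : InLp Ω (p i / (p i - 1 - b * p i)) (fun x => f i x - E i x) := (hf i).sub (hE i)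
    refine (integral_mul_abs_rpow_le (ht i) (hlt i) hΩ hg hχm hχ0 hχ1 hS hχS).trans ?_
    rw [mul_assoc]
    refine mul_le_mul_of_nonneg_left ?_ (hR0 i)
    -- The Hölder exponent left on the measure is exactly b p_i'; this is what the integrability
    -- exponent of the data is designed for.
    have e1 : 1 - p i / (p i - 1) / (p i / (p i - 1 - b * p i))
        = (b * (p i / (p i - 1)) - b * pm) + b * pm := by
      have := (hD i).ne'
      have := (hp1 i).ne'
      have := (hp0 i).ne'
      rw [sub_add_cancel]
      field_simp
      ring
    rw [e1, Real.rpow_add hSpos]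
    refine mul_le_mul_of_nonneg_right ?_ (by positivity)
    exact Real.rpow_le_rpow hSpos.le hmW (by linarith [hpm i])
  have hsum : ∑ i, K i * ∫ x in Ω, χ x * |f i x - E i x| ^ (p i / (p i - 1)) ≤
      (∑ i, K i * (R i * W ^ (b * (p i / (p i - 1)) - b * pm))) * m ^ (b * pm) := by
    rw [Finset.sum_mul]
    refine Finset.sum_le_sum fun i _ => ?_
    rw [mul_assoc]
    exact mul_le_mul_of_nonneg_left (hterm i) (hK0 i).le
  have hj : ∫ x in Ω, χ x * |d j x| ^ p j ≤ ∑ i, ∫ x in Ω, χ x * |d i x| ^ p i :=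
    Finset.single_le_sum (f := fun i => ∫ x in Ω, χ x * |d i x| ^ p i)
      (fun i _ => integral_nonneg fun x => mul_nonneg (hχ0 x) (by positivity)) (Finset.mem_univ j)
  have hmp : 0 ≤ m ^ (b * pm) := by positivity
  have h3 : ν / 2 * ∫ x in Ω, χ x * |d j x| ^ p j ≤
      (∑ i, K i * (R i * W ^ (b * (p i / (p i - 1)) - b * pm))) * m ^ (b * pm) :=
    (mul_le_mul_of_nonneg_left hj (by positivity)).trans (hEn.trans hsum)
  calc ∫ x in Ω, χ x * |d j x| ^ p j = 2 / ν * (ν / 2 * ∫ x in Ω, χ x * |d j x| ^ p j) := by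
        field_simp
    _ ≤ 2 / ν * ((∑ i, K i * (R i * W ^ (b * (p i / (p i - 1)) - b * pm))) * m ^ (b * pm)) :=
        mul_le_mul_of_nonneg_left h3 (by positivity)
    _ ≤ _ := by rw [← mul_assoc, add_mul]; linarith

/-- Exponent bookkeeping for the composition `a i (x, Dθ)`. -/
theorem div_sub_mul_le {P Q κ b : ℝ} (hP : 0 < P) (hPQ : P < Q) (hbκ : b < κ)
    (hb : b ≤ (1 - P / Q) * κ) : κ / (κ - b) * P ≤ Q := by
  have hQ : 0 < Q := hP.trans hPQ
  rw [div_mul_eq_mul_div, div_le_iff₀ (by linarith)]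
  have := mul_le_mul_of_nonneg_left hb hQ.le
  have e : Q * ((1 - P / Q) * κ) = (Q - P) * κ := by field_simp
  rw [e] at this
  linarith

end AnisoDirichlet

/-! ### The main theorem -/

theorem theorem1p2 (n : ℕ) (hn : 2 ≤ n) (Ω : Set (Pt n)) (hΩo : IsOpen Ω)
    (hΩb : Bornology.IsBounded Ω)
    (p q : Fin n → ℝ) (hp : ∀ k, 1 < p k) (hpq : ∀ k, p k < q k) (hpn : pBar p < n)
    (a : Fin n → Pt n → Pt n → ℝ) (ha : ∀ i, IsCaratheodory Ω (a i))
    (h : Pt n → ℝ) (hh0 : ∀ᵐ x ∂(volume.restrict Ω), 0 ≤ h x)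
    (hh : InLp Ω (⨆ k, q k / p k) h)
    (c₁ : ℝ)
    (hgrowth : ∀ᵐ x ∂(volume.restrict Ω), ∀ z : Pt n, ∀ i,
      |a i x z| ≤ c₁ * (h x + ∑ j, |z j| ^ p j) ^ (1 - 1 / p i))
    (ν : ℝ) (hν : 0 < ν)
    (hmono : ∀ᵐ x ∂(volume.restrict Ω), ∀ z z' : Pt n,
      ν * ∑ i, |z i - z' i| ^ p i ≤ ∑ i, (a i x z - a i x z') * (z i - z' i))
    (θ : Pt n → ℝ) (hθ : θ ∈ anisoSobolev Ω q)
    (b : ℝ) (hb0 : 0 < b)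
    (hb1 : b ≤ (⨅ j, (1 - p j / q j)) * ⨅ i, (1 - 1 / p i))
    (hb2 : b < (pMax p - 1) / pMax p * (pBar p / pBarStar p))
    (f : Fin n → Pt n → ℝ)
    (hf : ∀ i, InLp Ω (p i / (p i - 1 - b * p i)) (f i))
    (u : Pt n → ℝ) (hu : IsDirichletSolution Ω p a f θ u) :
    pBarStar p < tExp p b ∧ u - θ ∈ weakLp Ω (tExp p b) := by
  have hn' : (2 : ℝ) ≤ n := by exact_mod_cast hn
  have hΩ : volume Ω ≠ ⊤ := hΩb.measure_lt_top.ne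
  have : IsFiniteMeasure (volume.restrict Ω) := ⟨by simpa using hΩ.lt_top⟩
  have hp0 : ∀ i, 0 < p i := fun i => by linarith [hp i]
  have hp1 : ∀ i, 0 < p i - 1 := fun i => by linarith [hp i]
  have hκ : ∀ i, 0 < 1 - 1 / p i := fun i => by
    rw [sub_pos, div_lt_one (hp0 i)]; exact hp i
  have hbij := le_one_sub_mul_of_le_iInf hp hpq hb1
  have hbκ : ∀ i, b < 1 - 1 / p i := fun i => by
    refine (hbij i i).trans_lt (mul_lt_of_lt_one_left (hκ i) ?_)
    have := div_pos (hp0 i) ((hp0 i).trans (hpq i))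
    linarith
  -- the exponents
  have hσ1 := one_lt_sum_one_div hn hp hpn
  have hs0 : 0 < pBarStar p := by
    rw [pBarStar_eq_div hn hp hpn]; exact div_pos (by linarith) (by linarith)
  have hpb0 : 0 < pBar p := by
    rw [pBar_eq_div]; exact div_pos (by linarith) (by linarith)
  have hpM : 1 < pMax p := (hp ⟨0, by omega⟩).trans_le
    (le_ciSup (f := p) (Set.finite_range p).bddAbove ⟨0, by omega⟩)
  set s := pBarStar p
  set pm := pMax p / (pMax p - 1) with hpm
  have hpm0 : 0 < pm := div_pos (by linarith) (by linarith)
  set β := b * s / pBar p * pm with hβdef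
  have hβ0 : 0 < β := by positivity
  -- This is `hb2` multiplied by (p̄*/p̄) p_m'.
  have hβ1 : β < 1 := by
    have h1 : 0 < pMax p - 1 := by linarith
    have h2 := mul_lt_mul_of_pos_right hb2 (by positivity : 0 < s / pBar p * pm)
    have h3 : (pMax p - 1) / pMax p * (pBar p / s) * (s / pBar p * pm) = 1 := by
      rw [hpm]; field_simp
    rw [h3] at h2
    refine lt_of_eq_of_lt ?_ h2
    rw [hβdef]; ring
  have htExp : tExp p b = s / (1 - β) := rfl
  rw [htExp]
  refine ⟨by rw [lt_div_iff₀ (by linarith)]; nlinarith, ?_⟩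
  -- weak derivatives
  obtain ⟨⟨hv0, hvD⟩, Du, hDu, hweak⟩ := hu
  choose d hd hdL using hvD
  choose e he heL using hθ.2
  set v := u - θ with hv
  have hvI := hv0.1.1.integrable
  have heI := fun k => integrable_of_mem_sobolev11 hΩo hθ.1 (he k)
  have hdI := fun k => integrable_of_mem_sobolev11 hΩo hv0.1 (hd k)
  have hDue : ∀ k, Du k =ᵐ[volume.restrict Ω] d k + e k := fun k => by
    have := (hd k).add (he k) hvI hθ.1.1.integrable (hdI k) (heI k)
    rw [hv, sub_add_cancel] at this
    exact (hDu k).ae_eq hΩo this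
  obtain ⟨φ, hφ⟩ := exists_isTestLimit hΩo hv0 hd
  have heLp : ∀ j, InLp Ω (p j) (e j) := fun j => (heL j).mono_exponent hΩ (hpq j).le
  have hDuL : ∀ j, InLp Ω (p j) (Du j) := fun j =>
    MemLp.ae_eq (hDue j).symm (MemLp.add (hdL j) (heLp j))
  -- the fields `a i (x, Du)` and `a i (x, Dθ)`
  have hgr : ∀ i, ∀ᵐ x ∂(volume.restrict Ω), ∀ z : Pt n,
      |a i x z| ≤ c₁ * (h x + ∑ j, |z j| ^ p j) ^ (1 - 1 / p i) := fun i => by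
    filter_upwards [hgrowth] with x hx z using hx z i
  have hhρ : ∀ ρ j, ρ * p j ≤ q j → InLp Ω ρ h := fun ρ j hρ => by
    refine hh.mono_exponent hΩ ?_
    refine le_trans ?_ (le_ciSup (f := fun k => q k / p k) (Set.finite_range _).bddAbove j)
    rwa [le_div_iff₀ (hp0 j)]
  have hA : ∀ i, InLp Ω (p i / (p i - 1)) (fun x => a i x (fun j => Du j x)) := fun i => by
    have := inLp_of_growth hp (ha i) (hκ i) (hgr i) hh0
      (hhρ 1 i (by linarith [hpq i])) (z := Du) (fun j => by rw [one_mul]; exact hDuL j)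
    convert this using 1
    have := (hp0 i).ne'
    have := (hp1 i).ne'
    field_simp
  have hE : ∀ i, InLp Ω (p i / (p i - 1 - b * p i)) (fun x => a i x (fun j => e j x)) :=
    fun i => by
    -- This ρ is the one for which ρ / (1 - 1 / p i) is the integrability exponent of f i; the bound
    -- `hb1` keeps ρ p_j ≤ q_j.
    have hρ : ∀ j, (1 - 1 / p i) / (1 - 1 / p i - b) * p j ≤ q j := fun j =>
      div_sub_mul_le (hp0 j) (hpq j) (hbκ i) (hbij i j)
    have := inLp_of_growth hp (ha i) (hκ i) (hgr i) hh0 (hhρ _ i (hρ i)) (z := e)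
      (fun j => (heL j).mono_exponent hΩ (hρ j))
    convert this using 1
    rw [div_right_comm, div_self (hκ i).ne']
    have h1 : p i - 1 - b * p i = p i * (1 - 1 / p i - b) := by
      have := (hp0 i).ne'
      field_simp
    rw [h1, div_mul_eq_div_div, div_self (hp0 i).ne']
  have hcoer : ∀ᵐ x ∂(volume.restrict Ω), ν * ∑ i, |d i x| ^ p i ≤
      ∑ i, (a i x (fun j => Du j x) - a i x (fun j => e j x)) * d i x := by
    filter_upwards [hmono, ae_all_iff.2 hDue] with x hx hxe
    have h1 : ∀ i, Du i x - e i x = d i x := fun i => by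
      rw [hxe i, Pi.add_apply, add_sub_cancel_right]
    have := hx (fun j => Du j x) (fun j => e j x)
    simpa only [h1] using this
  obtain ⟨C₀, hC₀, henergy⟩ := exists_energy_decay hΩ hp hν hb0 hbκ hA hE hf hdL hcoer
  obtain ⟨C₁, hC₁, hsob⟩ := exists_anisotropic_sobolev hn hΩ hp hpn
  obtain ⟨c, hc, htrunc⟩ := exists_smooth_truncation
  have hvm : AEStronglyMeasurable v (volume.restrict Ω) := hvI.aestronglyMeasurable
  set S : ℝ → Set (Pt n) := fun L => {x | L < |v x|}
  have hS : ∀ L, NullMeasurableSet (S L) (volume.restrict Ω) := fun L =>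
    nullMeasurableSet_lt aemeasurable_const hvm.aemeasurable.abs
  -- the decay of the distribution function
  have hdecay : ∀ L, 0 < L → (volume.restrict Ω).real (S (2 * L)) ≤
      C₁ * C₀ ^ (s / pBar p) / c ^ s / L ^ s * (volume.restrict Ω).real (S L) ^ β := by
    intro L hL
    -- The energy bound asks for positive measure; in the null case the inclusion of S (2 * L) in S
    -- L suffices.
    rcases (measureReal_nonneg (μ := volume.restrict Ω) (s := S L)).eq_or_lt with hm | hm
    · rw [← hm, Real.zero_rpow hβ0.ne', mul_zero, hm]
      exact measureReal_mono fun x (hx : 2 * L < |v x|) => show L < |v x| by linarith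
    obtain ⟨G, hG, hGz, hG1, hGb, hGM⟩ := htrunc L (2 * L) hL (by linarith)
    have hLL : c * (2 * L - L) = c * L := by ring
    rw [hLL] at hGb hGM
    have hG' : ∀ y, |deriv G y| ≤ 1 := fun y => by
      rw [abs_of_nonneg (hG1 y).1]; exact (hG1 y).2
    have hw := hφ.comp hG (hGz 0 (by simpa using hL.le)).1 hG'
    have hχm : AEStronglyMeasurable (fun x => deriv G (v x)) (volume.restrict Ω) :=
      (hG.continuous_deriv (by simp)).comp_aestronglyMeasurable hvm
    have hχd := fun k => (hdL k).bdd_mul hχm (fun x => (hG1 _).1) (fun x => (hG1 _).2)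
    -- G(v) is admissible, and its gradient is G'(v) d, the form that `henergy` takes as input.
    have heq := hweak _ ⟨hw.mem_sobolev11Zero, fun k => ⟨_, hw.hasWeakPartial k, hχd k⟩⟩ _
      hw.hasWeakPartial
    have hen := henergy (fun x => deriv G (v x)) (S L) hχm (fun x => (hG1 _).1)
      (fun x => (hG1 _).2) (hS L) (fun x hx => (hGz _ (not_lt.1 hx)).2) hm heq
    have hY : 0 < C₀ * (volume.restrict Ω).real (S L) ^ (b * pm) := by positivity
    have hgY : ∀ j, ∫ x in Ω, |deriv G (v x) * d j x| ^ p j ≤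
        C₀ * (volume.restrict Ω).real (S L) ^ (b * pm) := by
      intro j
      refine le_trans (integral_mono ((hχd j).integrable_abs_rpow (hp0 j))
        (((hdL j).integrable_abs_rpow (hp0 j)).bdd_mul hχm (c := 1)
          (Eventually.of_forall fun x => hG' _)) fun x => ?_) (hen j)
      simp only
      rw [abs_mul, abs_of_nonneg (hG1 _).1, Real.mul_rpow (hG1 _).1 (abs_nonneg _)]
      refine mul_le_mul_of_nonneg_right ?_ (by positivity)
      exact Real.rpow_le_self_of_le_one (hG1 _).1 (hG1 _).2 (hp j).le
    have hT := hsob _ _ _ (c * L) _ hw (fun m x => hGb _) hχd hY hgY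
    have hwint : Integrable (fun x => |G (v x)| ^ s) (volume.restrict Ω) := by
      refine Integrable.of_bound (C := (c * L) ^ s)
        ((hG.continuous.comp_aestronglyMeasurable hvm).aemeasurable.abs.pow_const
          s).aestronglyMeasurable (Eventually.of_forall fun x => ?_)
      rw [Real.norm_eq_abs, abs_of_nonneg (by positivity)]
      exact Real.rpow_le_rpow (abs_nonneg _) (hGb _) hs0.le
    -- Markov's inequality at the value that |G(v)|^s takes on S (2 * L).
    have hmark := mul_meas_ge_le_integral_of_nonneg (μ := volume.restrict Ω)
      (Eventually.of_forall fun x => by positivity) hwint ((c * L) ^ s)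
    have hsub : (volume.restrict Ω).real (S (2 * L)) ≤
        (volume.restrict Ω).real {x | (c * L) ^ s ≤ |G (v x)| ^ s} :=
      measureReal_mono fun x hx => by
        simp only [Set.mem_ofPred_eq, hGM _ hx, le_refl]
    have hcL : 0 < (c * L) ^ s := by positivity
    have hchain : (c * L) ^ s * (volume.restrict Ω).real (S (2 * L)) ≤
        C₁ * (C₀ * (volume.restrict Ω).real (S L) ^ (b * pm)) ^ (s / pBar p) :=
      (mul_le_mul_of_nonneg_left hsub hcL.le).trans (hmark.trans hT)
    rw [Real.mul_rpow hC₀.le (by positivity), ← Real.rpow_mul hm.le] at hchain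
    have e1 : b * pm * (s / pBar p) = β := by rw [hβdef]; ring
    rw [e1, mul_comm, ← le_div_iff₀ hcL, Real.mul_rpow hc.le hL.le] at hchain
    refine hchain.trans (le_of_eq ?_)
    field_simp
  obtain ⟨K, hK, hKb⟩ := exists_decay_of_doubling
    (φ := fun L => (volume.restrict Ω).real (S L)) (fun L => measureReal_nonneg)
    (fun L => measureReal_mono (Set.subset_univ _)) (by positivity) hs0 hβ0.le hβ1 hdecay
  refine ⟨hvm, K, hK, fun L hL => ?_⟩
  have e1 : volume {x ∈ Ω | L < |v x|} = volume.restrict Ω (S L) := by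
    rw [Measure.restrict_apply₀' hΩo.measurableSet.nullMeasurableSet, Set.inter_comm]
    rfl
  rw [e1, ← ofReal_measureReal]
  exact ENNReal.ofReal_le_ofReal (hKb L hL)
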